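/- Let $k$ be an algebraically closed field of characteristic $p>0$, let $k[\epsilon]=k[\epsilon]/(\epsilon^2)$, let $C_0$ be a smooth proper curve over $k$ and $\mathcal E_0$ a vector bundle of rank $r$ on $C_0$, and let $C=C_0\times_k \operatorname{Spec} k[\epsilon]$ and $\mathcal E$ be obtained from $C_0$ and $\mathcal E_0$ by base change to $k[\epsilon]$. Let $F\colon C\to C^{(p)}$ be the relative Frobenius morphism of $C$ over $k[\epsilon]$. Let $\nabla$ be a rational connection on $\mathcal E$ relative to $k[\epsilon]$ (a connection on a dense open subset, which may have poles elsewhere), and let $\nabla_0$ be the rational connection on $\mathcal E_0$ that it induces modulo $\epsilon$. Write $\mathcal E^{\nabla}$ for the sheaf of sections $s$ of $\mathcal E$ with $\nabla s=0$, viewed as an $\mathcal O_{C^{(p)}}$-module, and similarly $\mathcal E_0^{\nabla_0}$. Suppose that * $\nabla$ is logarithmic: at every point $x$ of $C_0$, the connection $\nabla$ has at most a simple pole, i.e. $t\nabla$ is regular at $x$ for every function $t$ on $C_0$ vanishing at $x$; * $\nabla$ has vanishing $p$-curvature; * every pole of $\nabla$ is a pole of $\nabla_0$; * at every pole of $\nabla_0$,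 the exponents $e_1,\dots,e_r$ of $\nabla_0$ (the eigenvalues of its residue, so that formally locally $\nabla_0$ is given, in a suitable basis, by the diagonal matrix with entries $e_i\,t^{-1}dt$, $e_i\in\mathbb F_p$) are all non-zero. Then: 1. $\mathcal E^{\nabla}$ is locally free on $C^{(p)}$ of rank $r=\operatorname{rk}\mathcal E$; 2. the natural map $\mathcal E^{\nabla}/\epsilon\mathcal E^{\nabla}\to \mathcal E_0^{\nabla_0}$ is an isomorphism. -/

import Mathlib

open AlgebraicGeometry CategoryTheory TopologicalSpace
open scoped TensorProduct DualNumber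

universe u

noncomputable section

namespace LogConn

/-! ## Dual numbers and extension of scalars from `k` to `k[ε]` -/

section Dual

/-- A shortcut, to fix the path by which the ring structure on `R[ε]` is found. -/
instance dualCommRing (R : Type*) [CommRing R] : CommRing R[ε] := TrivSqZeroExt.commRing

/-- The ring homomorphism `A[ε] → B[ε]`, `a + a'ε ↦ f a + (f a')ε`. -/
def dualMap {A B : Type*} [CommRing A] [CommRing B] (f : A →+* B) : A[ε] →+* B[ε] where
  toFun x := (f x.fst, f x.snd)
  map_one' := TrivSqZeroExt.ext (map_one f) (map_zero f)
  map_zero' := TrivSqZeroExt.ext (map_zero f) (map_zero f)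
  map_mul' x y := TrivSqZeroExt.ext
    ((congrArg f (TrivSqZeroExt.fst_mul x y)).trans (map_mul f _ _))
    (by
      change f (x * y).snd = f x.fst * f y.snd + f x.snd * f y.fst
      rw [DualNumber.snd_mul, map_add, map_mul, map_mul])
  map_add' x y := TrivSqZeroExt.ext (map_add f _ _) (map_add f _ _)

/-- For a `k`-algebra `A`, the base change `A[ε]` is a `k[ε]`-algebra. -/
instance dualAlgebra (k A : Type*) [CommRing k] [CommRing A] [Algebra k A] :
    Algebra k[ε] A[ε] := (dualMap (algebraMap k A)).toAlgebra

instance (k : Type*) [CommRing k] (p : ℕ) [CharP k p] : CharP k[ε] p :=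
  charP_of_injective_algebraMap (R := k) TrivSqZeroExt.inl_injective p

/-- The base change `M[ε] = M ⊕ Mε` of an `A`-module `M` to `A[ε]`. -/
def EpsExt (M : Type*) : Type _ := M × M

namespace EpsExt

variable {M N : Type*} [AddCommGroup M] [AddCommGroup N]

instance : AddCommGroup (EpsExt M) := inferInstanceAs (AddCommGroup (M × M))

/-- `m + m'ε`. -/
def mk (m m' : M) : EpsExt M := (m, m')

/-- Reduction modulo `ε`: `m + m'ε ↦ m`. -/
def fst : EpsExt M →+ M := AddMonoidHom.fst M M

/-- The coefficient of `ε`: `m + m'ε ↦ m'`. -/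
def snd : EpsExt M →+ M := AddMonoidHom.snd M M

/-- The inclusion `M → M[ε]`. -/
def inl : M →+ EpsExt M := AddMonoidHom.inl M M

@[ext] theorem ext {x y : EpsExt M} (h₁ : fst x = fst y) (h₂ : snd x = snd y) : x = y :=
  Prod.ext h₁ h₂

@[simp] theorem fst_mk (m m' : M) : fst (mk m m') = m := rfl
@[simp] theorem snd_mk (m m' : M) : snd (mk m m') = m' := rfl

@[simp] theorem fst_inl (m : M) : fst (inl m) = m := rfl
@[simp] theorem snd_inl (m : M) : snd (inl m) = 0 := rfl

/-- `(a + a'ε) • (m + m'ε) = a • m + (a • m' + a' • m)ε`. -/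
instance {A : Type*} [CommRing A] [Module A M] : Module A[ε] (EpsExt M) where
  smul a m := mk (a.fst • fst m) (a.fst • snd m + a.snd • fst m)
  one_smul m := ext (one_smul A (fst m)) (by
    change (1 : A) • snd m + (0 : A) • fst m = snd m
    simp)
  mul_smul a b m := ext (mul_smul a.fst b.fst (fst m)) (by
    change (a * b).fst • snd m + (a * b).snd • fst m =
      a.fst • (b.fst • snd m + b.snd • fst m) + a.snd • (b.fst • fst m)
    rw [TrivSqZeroExt.fst_mul, DualNumber.snd_mul]
    module)
  smul_zero a := ext (smul_zero a.fst) (by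
    change a.fst • (0 : M) + a.snd • (0 : M) = 0
    simp)
  smul_add a m n := ext (smul_add a.fst (fst m) (fst n)) (by
    change a.fst • (snd m + snd n) + a.snd • (fst m + fst n) =
      (a.fst • snd m + a.snd • fst m) + (a.fst • snd n + a.snd • fst n)
    simp only [smul_add]
    abel)
  add_smul a b m := ext (add_smul a.fst b.fst (fst m)) (by
    change (a.fst + b.fst) • snd m + (a.snd + b.snd) • fst m =
      (a.fst • snd m + a.snd • fst m) + (b.fst • snd m + b.snd • fst m)
    simp only [add_smul]
    abel)
  zero_smul m := ext (zero_smul A (fst m)) (by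
    change (0 : A) • snd m + (0 : A) • fst m = 0
    simp)

@[simp] theorem fst_smul {A : Type*} [CommRing A] [Module A M] (a : A[ε]) (m : EpsExt M) :
    fst (a • m) = a.fst • fst m := rfl

@[simp] theorem snd_smul {A : Type*} [CommRing A] [Module A M] (a : A[ε]) (m : EpsExt M) :
    snd (a • m) = a.fst • snd m + a.snd • fst m := rfl

/-- The additive map `m + m'ε ↦ f m + (f m')ε`. -/
def map (f : M →+ N) : EpsExt M →+ EpsExt N := AddMonoidHom.prodMap f f

@[simp] theorem fst_map (f : M →+ N) (m : EpsExt M) : fst (map f m) = f (fst m) := rfl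
@[simp] theorem snd_map (f : M →+ N) (m : EpsExt M) : snd (map f m) = f (snd m) := rfl

end EpsExt

end Dual

/-! ## Connections on modules -/

section Connection

/-- A connection on the `A`-module `M`, relative to `B`. Additivity and the Leibniz rule
imply `B`-linearity, as `d b = 0` for `b` in `B`. -/
structure Connection (B A M : Type*) [CommRing B] [CommRing A] [Algebra B A] [AddCommGroup M]
    [Module A M] where
  /-- the underlying additive map `∇` -/
  toFun : M →+ Ω[A⁄B] ⊗[A] M
  leibniz : ∀ (a : A) (m : M), toFun (a • m) = a • toFun m + KaehlerDifferential.D B A a ⊗ₜ[A] m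

variable {B A M : Type*} [CommRing B] [CommRing A] [Algebra B A] [AddCommGroup M] [Module A M]

/-- The contraction `Ω ⊗ M → M` with a derivation `D`. -/
def contract (D : Derivation B A A) : Ω[A⁄B] ⊗[A] M →ₗ[A] M :=
  TensorProduct.lift ((LinearMap.lsmul A M).comp D.liftKaehlerDifferential)

/-- The covariant derivative `∇_D : M → M` along a derivation `D`. -/
def Connection.covDeriv (nabla : Connection B A M) (D : Derivation B A A) : M →+ M :=
  (contract D).toAddMonoidHom.comp nabla.toFun

/-- The Leibniz rule for the `p`-th iterate of a derivation in characteristic `p`. -/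
theorem iterate_prime_leibniz (p : ℕ) [Fact p.Prime] [CharP B p] (D : Derivation B A A) (a b : A) :
    D^[p] (a * b) = a * D^[p] b + b * D^[p] a := by
  let X : Module.End B (A ⊗[B] A) := TensorProduct.map (D : A →ₗ[B] A) LinearMap.id
  let Y : Module.End B (A ⊗[B] A) := TensorProduct.map LinearMap.id (D : A →ₗ[B] A)
  have hXY : Commute X Y := by
    apply TensorProduct.ext'
    intro x y
    simp [X, Y]
  have hX (n : ℕ) (x y : A) : (X ^ n) (x ⊗ₜ y) = (D^[n] x) ⊗ₜ y := by
    induction n with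
    | zero => simp
    | succ n ih => rw [pow_succ', Module.End.mul_apply, ih, Function.iterate_succ_apply']; simp [X]
  have hY (n : ℕ) (x y : A) : (Y ^ n) (x ⊗ₜ y) = x ⊗ₜ (D^[n] y) := by
    induction n with
    | zero => simp
    | succ n ih => rw [pow_succ', Module.End.mul_apply, ih, Function.iterate_succ_apply']; simp [Y]
  have hmul (n : ℕ) (z : A ⊗[B] A) :
      LinearMap.mul' B A (((X + Y) ^ n) z) = D^[n] (LinearMap.mul' B A z) := by
    induction n with
    | zero => simp
    | succ n ih =>
      rw [pow_succ', Module.End.mul_apply, Function.iterate_succ_apply', ← ih]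
      generalize ((X + Y) ^ n) z = w
      induction w with
      | zero => simp
      | tmul x y => simp [X, Y, mul_comm, add_comm]
      | add u v hu hv => simp only [map_add, hu, hv]
  have hp : ((p : ℕ) : Module.End B (A ⊗[B] A)) = 0 := by
    have := map_natCast (algebraMap B (Module.End B (A ⊗[B] A))) p
    rw [← this, CharP.cast_eq_zero, map_zero]
  obtain ⟨r, hr⟩ := hXY.exists_add_pow_prime_eq (Fact.out : p.Prime)
  rw [hp, zero_mul, zero_mul, zero_mul, add_zero] at hr
  have := hmul p (a ⊗ₜ b)
  rw [hr, LinearMap.add_apply, hX, hY, map_add] at this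
  simp only [LinearMap.mul'_apply] at this
  rw [← this]
  ring

/-- In characteristic `p`, the `p`-th iterate of a derivation is a derivation. -/
def derivationPow (p : ℕ) [Fact p.Prime] [CharP B p] (D : Derivation B A A) : Derivation B A A :=
  Derivation.mk' ((D : A →ₗ[B] A) ^ p) fun a b ↦ by
    simpa [Module.End.pow_apply] using iterate_prime_leibniz p D a b

@[simp] theorem derivationPow_apply (p : ℕ) [Fact p.Prime] [CharP B p] (D : Derivation B A A)
    (a : A) : derivationPow p D a = D^[p] a := by
  simp [derivationPow, Module.End.pow_apply]

/-- The `p`-curvature `ψ(D) = (∇_D)^p - ∇_{D^p}` is zero for every derivation `D`. -/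
def Connection.HasVanishingPCurvature (p : ℕ) [Fact p.Prime] [CharP B p]
    (nabla : Connection B A M) : Prop :=
  ∀ (D : Derivation B A A) (m : M),
    (nabla.covDeriv D)^[p] m - nabla.covDeriv (derivationPow p D) m = 0

/-- The image in `A` of the relative Frobenius homomorphism `B ⊗_{Frob, B} A → A`,
`b ⊗ a ↦ b a ^ p`: the `B`-subalgebra of `A` generated by the `p`-th powers. -/
def frobeniusImage (p : ℕ) (B A : Type*) [CommRing B] [CommRing A] [Algebra B A] :
    Subalgebra B A :=
  Algebra.adjoin B (Set.range fun a : A ↦ a ^ p)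

variable {A₁ M₁ : Type*} [CommRing A₁] [AddCommGroup M₁]

/-- For a ring homomorphism `φ : A₁ → A` and a map `ψ : M₁ → M` compatible with it, the image of
`Ω ⊗ M₁` in `Ω ⊗ M`; since `a • (d b ⊗ s) = d b ⊗ (a • s)`, it is generated as a group by the
elements `d b ⊗ s`, for `b` in `A₁` and `s` in `M₁`. -/
def regularForms (B : Type*) [CommRing B] [Algebra B A] (φ : A₁ →+* A) (ψ : M₁ →+ M) :
    AddSubgroup (Ω[A⁄B] ⊗[A] M) :=
  AddSubgroup.closure {w | ∃ (b : A₁) (s : M₁), w = KaehlerDifferential.D B A (φ b) ⊗ₜ[A] ψ s}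

theorem D_frobeniusImage (p : ℕ) [CharP B p] [Algebra B A₁] (φ : A₁ →ₐ[B] A) {c : A₁}
    (hc : c ∈ frobeniusImage p B A₁) : KaehlerDifferential.D B A (φ c) = 0 := by
  induction hc using Algebra.adjoin_induction with
  | mem x hx =>
    obtain ⟨a, rfl⟩ := hx
    have hp : (p : A) = 0 := by
      rw [← map_natCast (algebraMap B A) p, CharP.cast_eq_zero, map_zero]
    simp only [map_pow, Derivation.leibniz_pow, ← Nat.cast_smul_eq_nsmul A, hp, zero_smul]
  | algebraMap r => rw [AlgHom.commutes, Derivation.map_algebraMap]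
  | add x y _ _ hx hy => rw [map_add, map_add, hx, hy, add_zero]
  | mul x y _ _ hx hy => rw [map_mul, Derivation.leibniz, hx, hy, smul_zero, smul_zero, add_zero]

/-- The submodule of horizontal elements of `M₁`, over the ring `frobeniusImage p B A₁`. Here `M₁`
is compared with the module `M`, on which the connection lives, by a map `ψ : M₁ → M` which is
semilinear with respect to `φ : A₁ → A`. -/
def Connection.horizontal (p : ℕ) [CharP B p] (nabla : Connection B A M)
    [Algebra B A₁] [Module A₁ M₁] (φ : A₁ →ₐ[B] A) (ψ : M₁ →+ M)
    (hψ : ∀ (a : A₁) (m : M₁), ψ (a • m) = φ a • ψ m) :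
    Submodule (frobeniusImage p B A₁) M₁ where
  carrier := {m | nabla.toFun (ψ m) = 0}
  zero_mem' := by simp
  add_mem' {x y} hx hy := by
    simp only [Set.mem_ofPred_eq] at hx hy ⊢
    rw [map_add, map_add, hx, hy, add_zero]
  smul_mem' c m hm := by
    simp only [Set.mem_ofPred_eq] at hm ⊢
    have h : KaehlerDifferential.D B A (φ c.1) = 0 := D_frobeniusImage p φ c.2
    rw [Subalgebra.smul_def, hψ, nabla.leibniz, hm, h, smul_zero, TensorProduct.zero_tmul, add_zero]

end Connection

/-! ## Reduction of a connection modulo `ε` -/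

section Reduction

variable (k A : Type*) [CommRing k] [CommRing A] [Algebra k A]

/-- The map `Ω_{A[ε]/k[ε]} → Ω_{A/k}`, `x d y ↦ x₀ d y₀` (see `reduceDiff_smul`,
`reduceDiff_D`). -/
def reduceDiff : Ω[A[ε]⁄k[ε]] →+ Ω[A⁄k] :=
  letI : Module A[ε] Ω[A⁄k] := Module.compHom _ (TrivSqZeroExt.fstHom A A A : A[ε] →+* A)
  letI : Module k[ε] Ω[A⁄k] := Module.compHom _ (algebraMap k[ε] A[ε])
  haveI : IsScalarTower k[ε] A[ε] Ω[A⁄k] := ⟨fun x y w ↦ by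
    rw [Algebra.smul_def, mul_smul]; rfl⟩
  (Derivation.liftKaehlerDifferential
    ({ toFun := fun y ↦ KaehlerDifferential.D k A y.fst
       map_add' := fun x y ↦ by simp
       map_smul' := fun x y ↦ by
         rw [Algebra.smul_def, TrivSqZeroExt.fst_mul]
         exact (congrArg _ (Algebra.smul_def x.fst y.fst).symm).trans
           ((Derivation.map_smul _ _ _).trans (algebraMap_smul A x.fst _).symm)
       map_one_eq_zero' := by simp
       leibniz' := fun x y ↦ by
         change KaehlerDifferential.D k A (x * y).fst =
           x.fst • KaehlerDifferential.D k A y.fst + y.fst • KaehlerDifferential.D k A x.fst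
         rw [TrivSqZeroExt.fst_mul, Derivation.leibniz] } :
      Derivation k[ε] A[ε] Ω[A⁄k])).toAddMonoidHom

variable {k A}

theorem reduceDiff_D (y : A[ε]) :
    reduceDiff k A (KaehlerDifferential.D k[ε] A[ε] y) = KaehlerDifferential.D k A y.fst := by
  let _ : Module A[ε] Ω[A⁄k] := Module.compHom _ (TrivSqZeroExt.fstHom A A A : A[ε] →+* A)
  let _ : Module k[ε] Ω[A⁄k] := Module.compHom _ (algebraMap k[ε] A[ε])
  have : IsScalarTower k[ε] A[ε] Ω[A⁄k] := ⟨fun x y w ↦ by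
    rw [Algebra.smul_def, mul_smul]; rfl⟩
  exact Derivation.liftKaehlerDifferential_comp_D _ y

theorem reduceDiff_smul (x : A[ε]) (w : Ω[A[ε]⁄k[ε]]) :
    reduceDiff k A (x • w) = x.fst • reduceDiff k A w := by
  let _ : Module A[ε] Ω[A⁄k] := Module.compHom _ (TrivSqZeroExt.fstHom A A A : A[ε] →+* A)
  let _ : Module k[ε] Ω[A⁄k] := Module.compHom _ (algebraMap k[ε] A[ε])
  have : IsScalarTower k[ε] A[ε] Ω[A⁄k] := ⟨fun x y w ↦ by
    rw [Algebra.smul_def, mul_smul]; rfl⟩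
  exact LinearMap.map_smul (Derivation.liftKaehlerDifferential (R := k[ε]) (S := A[ε]) (M := Ω[A⁄k]) _) x w

variable {M : Type*} [AddCommGroup M] [Module A M]

variable (k A M) in
/-- The map `Ω_{A[ε]/k[ε]} ⊗ M[ε] → Ω_{A/k} ⊗ M` given by setting `ε = 0`. -/
def reduceForms : Ω[A[ε]⁄k[ε]] ⊗[A[ε]] EpsExt M →+ Ω[A⁄k] ⊗[A] M :=
  TensorProduct.liftAddHom
    { toFun := fun w ↦
        ((TensorProduct.mk A Ω[A⁄k] M (reduceDiff k A w)).toAddMonoidHom).comp EpsExt.fst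
      map_zero' := by ext; simp
      map_add' := fun _ _ ↦ by ext; simp }
    fun x w m ↦ by simp [reduceDiff_smul]

@[simp] theorem reduceForms_tmul (w : Ω[A[ε]⁄k[ε]]) (m : EpsExt M) :
    reduceForms k A M (w ⊗ₜ m) = reduceDiff k A w ⊗ₜ EpsExt.fst m := rfl

theorem reduceForms_smul (x : A[ε]) (w : Ω[A[ε]⁄k[ε]] ⊗[A[ε]] EpsExt M) :
    reduceForms k A M (x • w) = x.fst • reduceForms k A M w := by
  induction w with
  | zero => simp
  | tmul w m => rw [TensorProduct.smul_tmul', reduceForms_tmul, reduceDiff_smul,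
      reduceForms_tmul, TensorProduct.smul_tmul']
  | add a b ha hb => simp only [smul_add, map_add, ha, hb]

/-- The connection `∇₀` on `M` induced by a connection `∇` on `M[ε]`. -/
def Connection.reduction (nabla : Connection k[ε] A[ε] (EpsExt M)) : Connection k A M where
  toFun := (reduceForms k A M).comp (nabla.toFun.comp EpsExt.inl)
  leibniz a m := by
    have h : EpsExt.inl (a • m) = (TrivSqZeroExt.inl a : A[ε]) • EpsExt.inl m :=
      EpsExt.ext (by simp) (by simp)
    simp [h, nabla.leibniz, reduceForms_smul, reduceDiff_D]

/-- `∇₀` is compatible with reduction modulo `ε`. -/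
theorem Connection.reduction_fst (nabla : Connection k[ε] A[ε] (EpsExt M)) (m : EpsExt M) :
    nabla.reduction.toFun (EpsExt.fst m) = reduceForms k A M (nabla.toFun m) := by
  have h : m = EpsExt.inl (EpsExt.fst m) + (ε : A[ε]) • EpsExt.inl (EpsExt.snd m) :=
    EpsExt.ext (by simp) (by simp)
  conv_rhs => rw [h]
  have hε : KaehlerDifferential.D k[ε] A[ε] (ε : A[ε]) = 0 := by
    have : (ε : A[ε]) = algebraMap k[ε] A[ε] ε :=
      TrivSqZeroExt.ext (map_zero (algebraMap k A)).symm (map_one (algebraMap k A)).symm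
    rw [this, Derivation.map_algebraMap]
  rw [map_add, map_add, nabla.leibniz, hε, TensorProduct.zero_tmul, add_zero, reduceForms_smul]
  simp [Connection.reduction]

/-- The homomorphism of `k[ε]`-algebras `A₁[ε] → A[ε]` induced by `φ : A₁ → A`. -/
def dualAlgHom {A₁ : Type*} [CommRing A₁] [Algebra k A₁] (φ : A₁ →ₐ[k] A) :
    A₁[ε] →ₐ[k[ε]] A[ε] where
  toRingHom := dualMap φ.toRingHom
  commutes' r := TrivSqZeroExt.ext (φ.commutes r.fst) (φ.commutes r.snd)

theorem EpsExt.map_smul {A₁ M₁ : Type*} [CommRing A₁] [Algebra k A₁] [AddCommGroup M₁]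
    [Module A₁ M₁] {φ : A₁ →ₐ[k] A} {ψ : M₁ →+ M}
    (hψ : ∀ (a : A₁) (m : M₁), ψ (a • m) = φ a • ψ m) (a : A₁[ε]) (m : EpsExt M₁) :
    EpsExt.map ψ (a • m) = dualAlgHom φ a • EpsExt.map ψ m :=
  EpsExt.ext (hψ _ _) (by
    simp only [EpsExt.snd_map, EpsExt.snd_smul, map_add, hψ]; rfl)

variable (p : ℕ) [CharP k p] {A₁ M₁ : Type*} [CommRing A₁] [Algebra k A₁] [AddCommGroup M₁]
  [Module A₁ M₁] (nabla : Connection k[ε] A[ε] (EpsExt M)) (φ : A₁ →ₐ[k] A) (ψ : M₁ →+ M)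
  (hψ : ∀ (a : A₁) (m : M₁), ψ (a • m) = φ a • ψ m)

/-- The submodule of horizontal elements of `M₁[ε]`, over the ring
`frobeniusImage p k[ε] A₁[ε]`. -/
def Connection.horizontalEps : Submodule (frobeniusImage p k[ε] A₁[ε]) (EpsExt M₁) :=
  nabla.horizontal p (dualAlgHom φ) (EpsExt.map ψ) (EpsExt.map_smul hψ)

/-- The submodule `ε H` of the module `H` of horizontal elements of `M₁[ε]`. -/
def Connection.epsMulHorizontal :
    Submodule (frobeniusImage p k[ε] A₁[ε]) (nabla.horizontalEps p φ ψ hψ) :=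
  LinearMap.range (LinearMap.lsmul (frobeniusImage p k[ε] A₁[ε]) (nabla.horizontalEps p φ ψ hψ)
    (algebraMap k[ε] (frobeniusImage p k[ε] A₁[ε]) ε))

/-- Reduction modulo `ε` sends horizontal elements for `∇` to horizontal elements for `∇₀`. -/
def Connection.reduceHorizontal :
    nabla.horizontalEps p φ ψ hψ →+ nabla.reduction.horizontal p φ ψ hψ where
  toFun s := ⟨EpsExt.fst s.1, by
    have h := nabla.reduction_fst (EpsExt.map ψ s.1)
    rwa [show nabla.toFun (EpsExt.map ψ s.1) = 0 from s.2, map_zero] at h⟩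
  map_zero' := rfl
  map_add' _ _ := rfl

/-- The natural map `H / ε H → H₀` from the horizontal elements for `∇` modulo `ε` to the
horizontal elements for `∇₀`. -/
def Connection.horizontalQuotientMap :
    nabla.horizontalEps p φ ψ hψ ⧸ (nabla.epsMulHorizontal p φ ψ hψ).toAddSubgroup →+
      nabla.reduction.horizontal p φ ψ hψ :=
  QuotientAddGroup.lift _ (nabla.reduceHorizontal p φ ψ hψ) (by
    rintro _ ⟨s, rfl⟩
    refine Subtype.ext ?_
    change (algebraMap k A₁ 0) • EpsExt.fst s.1 = 0
    rw [map_zero, zero_smul])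

end Reduction

/-! ## Curves and vector bundles -/

section Curve

/-- A smooth proper (integral) curve over `k`. -/
structure SmoothProperCurve (k : Type u) [Field k] where
  /-- the underlying scheme -/
  X : Scheme.{u}
  /-- the structure morphism -/
  str : X ⟶ Spec (.of k)
  isIntegral : IsIntegral X
  isProper : IsProper str
  smooth : SmoothOfRelativeDimension 1 str

attribute [instance] SmoothProperCurve.isIntegral SmoothProperCurve.isProper
  SmoothProperCurve.smooth

/-- The module structure on the stalk of a sheaf of modules. -/
instance stalkModule {X : Scheme.{u}} (E : X.Modules) (x : X) :
    Module (X.presheaf.stalk x) (E.presheaf.stalk x) :=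
  PresheafOfModules.instModuleCarrierStalkCommRingCatCarrierAbPresheafOpensCarrier
    (R := X.presheaf) E.val x

theorem germ_smul {X : Scheme.{u}} (E : X.Modules) (U : X.Opens) (x : X) (hx : x ∈ U)
    (a : Γ(X, U)) (s : Γ(E, U)) :
    E.presheaf.germ U x hx (a • s) =
      (X.presheaf.germ U x hx a) • (E.presheaf.germ U x hx s : E.presheaf.stalk x) :=
  PresheafOfModules.germ_smul (R := X.presheaf) E.val x U hx a s

/-- Restriction of sections of `E` from `V` to a smaller open set `U`. -/
def res {X : Scheme.{u}} (E : X.Modules) {U V : X.Opens} (h : U ≤ V) : Γ(E, V) →+ Γ(E, U) :=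
  (E.presheaf.map (homOfLE h).op).hom

/-- `E` is a vector bundle of rank `r`: every point has an open neighbourhood `U` with sections
`e 1, …, e r` of `E` on `U` which induce an isomorphism of sheaves between `𝒪 ^ r` and `E` on `U`,
that is, which restrict to a basis of the sections of `E` on every open subset of `U`. -/
def IsVectorBundle {X : Scheme.{u}} (E : X.Modules) (r : ℕ) : Prop :=
  ∀ x : X, ∃ U : X.Opens, x ∈ U ∧ ∃ e : Fin r → Γ(E, U), ∀ (W : X.Opens) (hW : W ≤ U),
    ∃ b : Module.Basis (Fin r) Γ(X, W) Γ(E, W), ∀ i, b i = res E hW (e i)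

variable {k : Type u} [Field k] (C : SmoothProperCurve k)

instance (U : C.X.Opens) : Algebra k Γ(C.X, U) :=
  ((C.X.presheaf.map (homOfLE le_top).op).hom.comp
    (C.str.appTop.hom.comp (Scheme.ΓSpecIso (.of k)).inv.hom)).toAlgebra

/-- The function field of the curve. -/
abbrev SmoothProperCurve.K : Type u := C.X.functionField

instance : Algebra k C.K :=
  ((C.X.presheaf.germ ⊤ (genericPoint C.X) trivial).hom.comp
    (algebraMap k Γ(C.X, ⊤))).toAlgebra

theorem generic_mem (U : C.X.Opens) [h : Nonempty U] : genericPoint C.X ∈ U :=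
  ((genericPoint_spec C.X).mem_open_set_iff U.isOpen).mpr (by simpa using h)

theorem generic_specializes (x : C.X) : genericPoint C.X ⤳ x :=
  (genericPoint_spec C.X).specializes trivial

/-- The inclusion of `𝒪(U)` in the function field. -/
def toK (U : C.X.Opens) [Nonempty U] : Γ(C.X, U) →ₐ[k] C.K where
  toRingHom := (C.X.presheaf.germ U (genericPoint C.X) (generic_mem C U)).hom
  commutes' r := by
    have h (V : C.X.Opens) (hV : genericPoint C.X ∈ V) := ConcreteCategory.congr_hom
      (C.X.presheaf.germ_res (homOfLE le_top) (genericPoint C.X) hV)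
      ((C.str.appTop.hom.comp (Scheme.ΓSpecIso (.of k)).inv.hom) r)
    exact (h U (generic_mem C U)).trans (h ⊤ trivial).symm

/-- The inclusion of the local ring at `x` in the function field. -/
def stalkToK (x : C.X) : C.X.presheaf.stalk x →+* C.K :=
  (C.X.presheaf.stalkSpecializes (generic_specializes C x)).hom

variable {C} (E : C.X.Modules)

/-- The fibre of `E` at the generic point. -/
abbrev genericFibre : Type u := E.presheaf.stalk (genericPoint C.X)

instance : Module C.K (genericFibre E) := stalkModule E (genericPoint C.X)

/-- The germ at the generic point of a section of `E` on `U`. -/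
def toGeneric (U : C.X.Opens) [Nonempty U] : Γ(E, U) →+ genericFibre E :=
  (E.presheaf.germ U (genericPoint C.X) (generic_mem C U)).hom

theorem toGeneric_smul (U : C.X.Opens) [Nonempty U] (a : Γ(C.X, U)) (s : Γ(E, U)) :
    toGeneric E U (a • s) = toK C U a • toGeneric E U s :=
  germ_smul E U (genericPoint C.X) (generic_mem C U) a s

/-- The map from the stalk of `E` at `x` to the generic fibre. -/
def stalkToGeneric (x : C.X) : E.presheaf.stalk x →+ genericFibre E :=
  (E.presheaf.stalkSpecializes (generic_specializes C x)).hom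

/-! ## Rational connections, poles, exponents -/

/-- A rational connection on the vector bundle `E` on `C`, relative to `k`. A connection on some
dense open subset is the same, up to shrinking the subset, as a connection on the
generic fibre. -/
abbrev RatConnection : Type u := Connection k C.K (genericFibre E)

/-- A rational connection on the vector bundle `E[ε]` on the curve `C[ε] = C × Spec k[ε]`,
relative to `k[ε]`. The local rings of `C[ε]` are the rings `𝒪_x[ε]`, and `C[ε]` has the same open
sets as `C`. -/
abbrev RatConnectionEps : Type u := Connection k[ε] C.K[ε] (EpsExt (genericFibre E))

variable {E}

/-- The elements of `Ω ⊗ E` at the generic point which are regular at `x`. -/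
def regularAt (E : C.X.Modules) (x : C.X) : AddSubgroup (Ω[C.K⁄k] ⊗[C.K] genericFibre E) :=
  regularForms k (stalkToK C x) (stalkToGeneric E x)

/-- The elements of `Ω ⊗ E[ε]` at the generic point of `C[ε]` which are regular at `x`. -/
def regularAtEps (E : C.X.Modules) (x : C.X) :
    AddSubgroup (Ω[C.K[ε]⁄k[ε]] ⊗[C.K[ε]] EpsExt (genericFibre E)) :=
  regularForms k[ε] (dualMap (stalkToK C x)) (EpsExt.map (stalkToGeneric E x))

/-- `x` is a pole of `∇₀`: it is not true that `∇₀` maps `E_x` to `Ω_x ⊗ E_x`. -/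
def IsPole (nabla : RatConnection E) (x : C.X) : Prop :=
  ¬ ∀ s : E.presheaf.stalk x, nabla.toFun (stalkToGeneric E x s) ∈ regularAt E x

/-- `x` is a pole of `∇`. -/
def IsPoleEps (nabla : RatConnectionEps E) (x : C.X) : Prop :=
  ¬ ∀ s : EpsExt (E.presheaf.stalk x),
    nabla.toFun (EpsExt.map (stalkToGeneric E x) s) ∈ regularAtEps E x

/-- `∇` is logarithmic, that is, has at most simple poles: `t • ∇ s` is regular at `x` for
all local sections `s` of `E[ε]` at `x` and all functions `t` on the curve `C` that vanish at `x`.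
-/
def IsLogarithmicEps (nabla : RatConnectionEps E) : Prop :=
  ∀ (x : C.X), ∀ t ∈ IsLocalRing.maximalIdeal (C.X.presheaf.stalk x),
    ∀ s : EpsExt (E.presheaf.stalk x),
      (TrivSqZeroExt.inl (stalkToK C x t) : C.K[ε]) •
        nabla.toFun (EpsExt.map (stalkToGeneric E x) s) ∈ regularAtEps E x

/-- `e` is an exponent of `∇₀` at `x`, that is, an eigenvalue of the residue of `∇₀` at `x`: for a
local coordinate `t` at `x` there is `s` in `E_x`, not zero in the fibre of `E` at `x`, such that
`∇₀ s - e (dt / t) ⊗ s` is regular at `x`. -/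
def IsExponent (nabla : RatConnection E) (x : C.X) (e : k) : Prop :=
  ∃ t : C.X.presheaf.stalk x, Irreducible t ∧
    ∃ s : E.presheaf.stalk x,
      s ∉ IsLocalRing.maximalIdeal (C.X.presheaf.stalk x) •
        (⊤ : Submodule (C.X.presheaf.stalk x) (E.presheaf.stalk x)) ∧
      ∃ w ∈ regularAt E x,
        stalkToK C x t • nabla.toFun (stalkToGeneric E x s) =
          algebraMap k C.K e •
            (KaehlerDifferential.D k C.K (stalkToK C x t) ⊗ₜ[C.K] stalkToGeneric E x s) +
          stalkToK C x t • w

/-! ## Sheaves of horizontal sections -/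

variable (p : ℕ) [Fact p.Prime] [CharP k p]

/-- The sections on `U` of the structure sheaf of the Frobenius twist `C[ε] ^ (p)` of `C[ε]`
relative to `k[ε]`. As `C[ε]` is smooth over `k[ε]`, the relative Frobenius morphism
`F : C[ε] → C[ε] ^ (p)` is a homeomorphism, and `𝒪_{C[ε] ^ (p)} → F_* 𝒪_{C[ε]}` is injective;
so sections are identified with their images. -/
abbrev twistedSectionsEps (U : C.X.Opens) : Subalgebra k[ε] Γ(C.X, U)[ε] :=
  frobeniusImage p k[ε] Γ(C.X, U)[ε]

/-- The module of horizontal sections of `∇` on `U`, over the structure sheaf of `C[ε] ^ (p)`. -/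
def kernelEps (nabla : RatConnectionEps E) (U : C.X.Opens) [Nonempty U] :
    Submodule (twistedSectionsEps p U) (EpsExt Γ(E, U)) :=
  nabla.horizontalEps p (toK C U) (toGeneric E U) (toGeneric_smul E U)

/-- The sheaf of horizontal sections of `∇` is locally free of rank `r` on `C[ε] ^ (p)`: every
point has an open neighbourhood `U` with horizontal sections `e 1, …, e r` on `U` which restrict
to a basis of the horizontal sections on every non-empty open subset of `U`. -/
def KernelIsLocallyFree (nabla : RatConnectionEps E) (r : ℕ) : Prop :=
  ∀ x : C.X, ∃ (U : C.X.Opens) (_ : Nonempty U), x ∈ U ∧ ∃ e : Fin r → kernelEps p nabla U,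
    ∀ (W : C.X.Opens) [Nonempty W] (hW : W ≤ U),
      ∃ b : Module.Basis (Fin r) (twistedSectionsEps p W) (kernelEps p nabla W),
        ∀ i, (b i : EpsExt Γ(E, W)) = EpsExt.map (res E hW) (e i)

/-- The natural map from the sheaf of horizontal sections of `∇`, modulo `ε`, to the sheaf of
horizontal sections of `∇₀` is an isomorphism of sheaves: every point has an open neighbourhood
`U` such that on every non-empty open subset of `U` the map is bijective. -/
def KernelQuotientMapIsIso (nabla : RatConnectionEps E) : Prop :=
  ∀ x : C.X, ∃ U : C.X.Opens, x ∈ U ∧ ∀ (W : C.X.Opens) [Nonempty W], W ≤ U →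
    Function.Bijective
      (nabla.horizontalQuotientMap p (toK C W) (toGeneric E W) (toGeneric_smul E W))

end Curve

end LogConn

end

/-!
The sections of `E[ε]` near a closed point `x` are described by eigenvectors. Let `t` be a
uniformizer at `x` and `Θ = ∇_{t d/dt}`. As `∇` is logarithmic, `Θ` preserves the stalk of `E[ε]` at
`x` (`covDeriv_mem_range_of_regularForms`), and as `(t d/dt) ^ p = t d/dt`, vanishing `p`-curvature
says that `Θ ^ p = Θ` (`IsCoordinate.iterate_covDeriv_eq`). So the stalk is spanned by eigenvectors
of `Θ` with eigenvalues in `𝔽_p` (`exists_eigenvector_sum`), and by Nakayama's lemma `r` of them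
reduce to a basis of the stalk of `E` (`exists_eigenbasis`). They extend to sections `g i` near `x`
with `Θ (g i) = -n i g i`, where `0 ≤ n i < p`.

A section `∑ a i g i` is horizontal if and only if `t d(a i)/dt = n i a i` for all `i`. A function
of the curve whose derivative `d/dt` vanishes is a `p`-th power, since the function field `K` is
`K ^ p (t)` (`exists_pow_eq_of_derivation_eq_zero`). As `t` has a simple zero at `x` and no other
zero nearby, and the local rings are normal, the solutions are exactly the `a i = t ^ (n i) b`,
where both coefficients of `b` are `p`-th powers of functions (`exists_toK_eq_of_pow`). Hence the
`t ^ (n i) g i` are a basis of the horizontal sections over the image of Frobenius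
(`EigenFrame.exists_basis`). The same computation modulo `ε` shows that the reductions of the
`t ^ (n i) g i` are a basis of the horizontal sections of `∇₀`, which gives the second claim
(`EigenFrame.bijective_horizontalQuotientMap`).

The argument is the same at poles and at regular points, and neighbourhoods of closed points cover
the curve (`exists_closedPoint`). That `Ω` is free of rank one gives the uniformizer which is a
coordinate (`exists_isCoordinate`).
-/

noncomputable section

namespace LogConn

/-! ### Differentials of the dual numbers -/

section DualDifferentials

variable {k A : Type*} [CommRing k] [CommRing A] [Algebra k A]

/-- The `k[ε]`-linear extension of a derivation: `a + a'ε ↦ D a + (D a')ε`. -/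
def dualDerivation (D : Derivation k A A) : Derivation k[ε] A[ε] A[ε] where
  toFun x := (D x.fst, D x.snd)
  map_add' x y := TrivSqZeroExt.ext (map_add D _ _) (map_add D _ _)
  map_smul' c x := by
    rw [RingHom.id_apply, Algebra.smul_def c x]
    refine Eq.trans ?_ (Algebra.smul_def _ _).symm
    refine TrivSqZeroExt.ext ?_ ?_
    · change D (algebraMap k A c.fst * x.fst) = algebraMap k A c.fst * D x.fst
      rw [← Algebra.smul_def, ← Algebra.smul_def, D.map_smul]
    · change D (algebraMap k A c.fst * x.snd + algebraMap k A c.snd * x.fst) =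
        algebraMap k A c.fst * D x.snd + algebraMap k A c.snd * D x.fst
      simp only [← Algebra.smul_def, D.map_smul, map_add]
  map_one_eq_zero' := TrivSqZeroExt.ext (D.map_one_eq_zero) (map_zero D)
  leibniz' x y := by
    refine TrivSqZeroExt.ext ?_ ?_
    · change D (x.fst * y.fst) = x.fst * D y.fst + y.fst * D x.fst
      rw [D.leibniz, smul_eq_mul, smul_eq_mul]
    · change D ((x * y).snd) = (x.fst * D y.snd + x.snd * D y.fst) +
        (y.fst * D x.snd + y.snd * D x.fst)
      rw [DualNumber.snd_mul, map_add, D.leibniz, D.leibniz]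
      simp only [smul_eq_mul]
      ring

@[simp] theorem fst_dualDerivation (D : Derivation k A A) (x : A[ε]) :
    (dualDerivation D x).fst = D x.fst := rfl

@[simp] theorem snd_dualDerivation (D : Derivation k A A) (x : A[ε]) :
    (dualDerivation D x).snd = D x.snd := rfl

theorem eps_eq_algebraMap : (ε : A[ε]) = algebraMap k[ε] A[ε] ε :=
  TrivSqZeroExt.ext (map_zero (algebraMap k A)).symm (map_one (algebraMap k A)).symm

theorem D_eps : KaehlerDifferential.D k[ε] A[ε] (ε : A[ε]) = 0 := by
  rw [eps_eq_algebraMap (k := k), Derivation.map_algebraMap]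

theorem dual_eq_inl_add (x : A[ε]) :
    x = TrivSqZeroExt.inl x.fst + (ε : A[ε]) * TrivSqZeroExt.inl x.snd :=
  TrivSqZeroExt.ext (by simp) (by simp)

/-- If `d t` generates the differentials of `A` over `k`, and `D` is the derivation `d / d t`, then
the same holds over the dual numbers. -/
theorem D_dual_eq_smul {t : A} {D : Derivation k A A}
    (hD : ∀ a : A, KaehlerDifferential.D k A a = D a • KaehlerDifferential.D k A t) (x : A[ε]) :
    KaehlerDifferential.D k[ε] A[ε] x = dualDerivation D x •
      KaehlerDifferential.D k[ε] A[ε] (TrivSqZeroExt.inl t) := by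
  have smul_A (a : A) (w : Ω[A[ε]⁄k[ε]]) : a • w = (TrivSqZeroExt.inl a : A[ε]) • w :=
    algebra_compatible_smul A[ε] a w
  have smul_k (c : k) (w : Ω[A[ε]⁄k[ε]]) : c • w = algebraMap k A c • w :=
    algebra_compatible_smul A c w
  -- the derivation `a ↦ d (a + 0 ε)` of `A` factors through the differentials of `A`
  let δ : Derivation k A Ω[A[ε]⁄k[ε]] :=
    { toFun := fun a ↦ KaehlerDifferential.D k[ε] A[ε] (TrivSqZeroExt.inl a)
      map_add' := fun a b ↦ by rw [TrivSqZeroExt.inl_add, map_add]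
      map_smul' := fun c a ↦ by
        have h : (TrivSqZeroExt.inl (c • a) : A[ε]) =
            (algebraMap k[ε] A[ε] (TrivSqZeroExt.inl c)) * TrivSqZeroExt.inl a := by
          refine TrivSqZeroExt.ext ?_ ?_
          · change c • a = algebraMap k A c * a
            rw [Algebra.smul_def]
          · change 0 = algebraMap k A c * 0 + algebraMap k A 0 * a
            simp
        rw [h, Derivation.leibniz, Derivation.map_algebraMap, smul_zero, add_zero]
        rw [RingHom.id_apply, smul_k, smul_A]
        congr 1
        exact TrivSqZeroExt.ext rfl (map_zero (algebraMap k A))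
      map_one_eq_zero' := by
        change KaehlerDifferential.D k[ε] A[ε] (TrivSqZeroExt.inl 1) = 0
        rw [TrivSqZeroExt.inl_one, Derivation.map_one_eq_zero]
      leibniz' := fun a b ↦ by
        change KaehlerDifferential.D k[ε] A[ε] (TrivSqZeroExt.inl (a * b)) = _
        rw [TrivSqZeroExt.inl_mul, Derivation.leibniz, smul_A, smul_A]
        rfl }
  have key (a : A) : KaehlerDifferential.D k[ε] A[ε] (TrivSqZeroExt.inl a) =
      (TrivSqZeroExt.inl (D a) : A[ε]) •
        KaehlerDifferential.D k[ε] A[ε] (TrivSqZeroExt.inl t) := by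
    have := congrArg δ.liftKaehlerDifferential (hD a)
    rwa [map_smul, Derivation.liftKaehlerDifferential_comp_D,
      Derivation.liftKaehlerDifferential_comp_D, smul_A] at this
  conv_lhs => rw [dual_eq_inl_add x]
  rw [map_add, Derivation.leibniz, D_eps, smul_zero, add_zero, key x.fst, key x.snd,
    smul_smul, ← add_smul]
  congr 1
  exact (dual_eq_inl_add (dualDerivation D x)).symm

theorem reduceDiff_contract (D : Derivation k A A) (w : Ω[A[ε]⁄k[ε]]) :
    D.liftKaehlerDifferential (reduceDiff k A w) =
      ((dualDerivation D).liftKaehlerDifferential w).fst := by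
  have hw : w ∈ Submodule.span A[ε] (Set.range (KaehlerDifferential.D k[ε] A[ε])) := by
    rw [KaehlerDifferential.span_range_derivation]; trivial
  induction hw using Submodule.span_induction with
  | mem x h =>
    obtain ⟨y, rfl⟩ := h
    rw [reduceDiff_D, Derivation.liftKaehlerDifferential_comp_D,
      Derivation.liftKaehlerDifferential_comp_D, fst_dualDerivation]
  | zero => simp
  | add x y _ _ hx hy => rw [map_add, map_add, hx, hy, map_add, TrivSqZeroExt.fst_add]
  | smul a x _ hx => rw [reduceDiff_smul, map_smul, hx, map_smul, smul_eq_mul, smul_eq_mul,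
      TrivSqZeroExt.fst_mul]

variable {M : Type*} [AddCommGroup M] [Module A M]

/-- Contraction with a derivation commutes with reduction modulo `ε`. -/
theorem contract_reduceForms (D : Derivation k A A) (w : Ω[A[ε]⁄k[ε]] ⊗[A[ε]] EpsExt M) :
    contract D (reduceForms k A M w) = EpsExt.fst (contract (dualDerivation D) w) := by
  induction w with
  | zero => simp
  | tmul w m =>
    rw [reduceForms_tmul]
    change D.liftKaehlerDifferential (reduceDiff k A w) • EpsExt.fst m =
      EpsExt.fst ((dualDerivation D).liftKaehlerDifferential w • m)
    rw [reduceDiff_contract, EpsExt.fst_smul]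
  | add a b ha hb => simp only [map_add, ha, hb]

theorem Connection.reduction_covDeriv_fst (nabla : Connection k[ε] A[ε] (EpsExt M))
    (D : Derivation k A A) (m : EpsExt M) :
    nabla.reduction.covDeriv D (EpsExt.fst m) =
      EpsExt.fst (nabla.covDeriv (dualDerivation D) m) := by
  change contract D (nabla.reduction.toFun (EpsExt.fst m)) = _
  rw [nabla.reduction_fst, contract_reduceForms]
  rfl

end DualDifferentials

/-! ### Connections when the differentials are generated by one element -/

section OneVariable

variable {B A M : Type*} [CommRing B] [CommRing A] [Algebra B A] [AddCommGroup M] [Module A M]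

theorem contract_D_tmul (D : Derivation B A A) (a : A) (m : M) :
    contract D (KaehlerDifferential.D B A a ⊗ₜ[A] m) = D a • m := by
  change D.liftKaehlerDifferential (KaehlerDifferential.D B A a) • m = _
  rw [Derivation.liftKaehlerDifferential_comp_D]

theorem contract_smul_left (u : A) (D : Derivation B A A) (w : Ω[A⁄B] ⊗[A] M) :
    contract (u • D) w = u • contract D w := by
  induction w with
  | zero => simp
  | tmul w m =>
    change (u • D).liftKaehlerDifferential w • m = u • D.liftKaehlerDifferential w • m
    have h : (u • D).liftKaehlerDifferential = u • D.liftKaehlerDifferential :=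
      Derivation.liftKaehlerDifferential_unique _ _ (by ext; simp)
    rw [h, LinearMap.smul_apply, smul_assoc]
  | add a b ha hb => simp only [map_add, ha, hb, smul_add]

theorem Connection.covDeriv_leibniz (nabla : Connection B A M) (D : Derivation B A A) (a : A)
    (m : M) : nabla.covDeriv D (a • m) = a • nabla.covDeriv D m + D a • m := by
  change contract D (nabla.toFun (a • m)) = a • contract D (nabla.toFun m) + _
  rw [nabla.leibniz, map_add, map_smul, contract_D_tmul]

theorem eq_D_tmul_contract {t : A} {D : Derivation B A A}
    (hD : ∀ a : A, KaehlerDifferential.D B A a = D a • KaehlerDifferential.D B A t)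
    (w : Ω[A⁄B] ⊗[A] M) : w = KaehlerDifferential.D B A t ⊗ₜ[A] contract D w := by
  have h (w : Ω[A⁄B]) : w = D.liftKaehlerDifferential w • KaehlerDifferential.D B A t := by
    have hw : w ∈ Submodule.span A (Set.range (KaehlerDifferential.D B A)) := by
      rw [KaehlerDifferential.span_range_derivation]; trivial
    induction hw using Submodule.span_induction with
    | mem x h =>
      obtain ⟨y, rfl⟩ := h
      rw [Derivation.liftKaehlerDifferential_comp_D, ← hD]
    | zero => simp
    | add x y _ _ hx hy => rw [map_add, add_smul, ← hx, ← hy]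
    | smul a x _ hx => rw [map_smul, smul_eq_mul, mul_smul, ← hx]
  induction w with
  | zero => simp
  | tmul w m =>
    change _ = _ ⊗ₜ[A] (D.liftKaehlerDifferential w • m)
    rw [← TensorProduct.smul_tmul, ← h]
  | add a b ha hb => rw [map_add, TensorProduct.tmul_add, ← ha, ← hb]

/-- If `d t` generates the differentials and `u` is a unit, a section is horizontal as soon as its
derivative along `u d / d t` vanishes. -/
theorem Connection.toFun_eq_zero_iff (nabla : Connection B A M) {t u : A} (hu : IsUnit u)
    {D : Derivation B A A}
    (hD : ∀ a : A, KaehlerDifferential.D B A a = D a • KaehlerDifferential.D B A t) (m : M) :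
    nabla.toFun m = 0 ↔ nabla.covDeriv (u • D) m = 0 := by
  constructor
  · intro h0
    change contract _ (nabla.toFun m) = 0
    rw [h0, map_zero]
  · intro h0
    change contract _ (nabla.toFun m) = 0 at h0
    rw [contract_smul_left, hu.smul_eq_zero] at h0
    rw [eq_D_tmul_contract hD (nabla.toFun m), h0, TensorProduct.tmul_zero]

/-- If `d t` generates the differentials and `θ = t d / d t`, then `θ ^ p = θ`, as both are
derivations which send `t` to `t`. So vanishing `p`-curvature means `∇_θ ^ p = ∇_θ`. -/
theorem Connection.HasVanishingPCurvature.iterate_covDeriv_eq {p : ℕ} [Fact p.Prime] [CharP B p]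
    {nabla : Connection B A M} (h : nabla.HasVanishingPCurvature p) {t : A} {D : Derivation B A A}
    (hD : ∀ a : A, KaehlerDifferential.D B A a = D a • KaehlerDifferential.D B A t)
    (hDt : D t = 1) (m : M) :
    (nabla.covDeriv (t • D))^[p] m = nabla.covDeriv (t • D) m := by
  have ht : (t • D) t = t := by rw [Derivation.smul_apply, hDt, smul_eq_mul, mul_one]
  have hθ : derivationPow p (t • D) = t • D := by
    have h1 (δ : Derivation B A A) (a : A) : δ a = D a * δ t := by
      have := congrArg δ.liftKaehlerDifferential (hD a)
      rwa [map_smul, Derivation.liftKaehlerDifferential_comp_D,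
        Derivation.liftKaehlerDifferential_comp_D, smul_eq_mul] at this
    ext a
    rw [h1 (derivationPow p (t • D)), h1 (t • D), derivationPow_apply, ht,
      Function.iterate_fixed ht]
  have := sub_eq_zero.mp (h (t • D) m)
  rwa [hθ] at this

end OneVariable

/-! ### Constants of a derivation on a function field of one variable -/

section Constants

/-- The subfield `K ^ p` of `p`-th powers, as an extension of a perfect field `k`. -/
def powField (k K : Type*) [Field k] [Field K] [Algebra k K] (p : ℕ) [Fact p.Prime] [CharP k p]
    [PerfectRing k p] : IntermediateField k K :=
  haveI : CharP K p := charP_of_injective_algebraMap (algebraMap k K).injective p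
  { (frobenius K p).fieldRange with
    algebraMap_mem' := fun c ↦ ⟨algebraMap k K (frobeniusEquiv k p |>.symm c), by
      rw [frobenius_def, ← map_pow, frobeniusEquiv_symm_pow_p]⟩ }

variable {k K : Type*} [Field k] [Field K] [Algebra k K] (p : ℕ) [Fact p.Prime] [CharP k p]
  [PerfectRing k p]

/-- If `d t` generates the differentials of `K` over `k`, then `K = K ^ p (t)`: the extension
`K / K ^ p (t)` has no differentials, hence is separable, and it is purely inseparable. -/
theorem adjoin_powField_eq_top [Algebra.EssFiniteType k K] (t : K)
    (ht : ∀ a : K, ∃ c : K, KaehlerDifferential.D k K a = c • KaehlerDifferential.D k K t) :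
    IntermediateField.adjoin (powField k K p) {t} = ⊤ := by
  set L := IntermediateField.adjoin (powField k K p) {t}
  have hCL : CharP L p := charP_of_injective_algebraMap (algebraMap k L).injective p
  have : IsScalarTower k L K := IsScalarTower.of_algebraMap_eq fun _ ↦ rfl
  have : Algebra.EssFiniteType L K := Algebra.EssFiniteType.of_comp k L K
  have htL : t ∈ L := IntermediateField.mem_adjoin_simple_self _ t
  have : Algebra.FormallyUnramified L K := by
    have h (a : K) : KaehlerDifferential.D L K a = 0 := by
      obtain ⟨c, hc⟩ := ht a
      have h1 := KaehlerDifferential.map_D k L K K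
      have h2 := congrArg (KaehlerDifferential.map k L K K) hc
      rw [map_smul, h1, h1] at h2
      refine h2.trans ?_
      have : KaehlerDifferential.D L K (algebraMap L K ⟨t, htL⟩) = 0 :=
        Derivation.map_algebraMap _ _
      exact (congrArg (c • ·) this).trans (smul_zero c)
    rw [Algebra.formallyUnramified_iff]
    refine subsingleton_of_forall_eq 0 fun w ↦ ?_
    have hw : w ∈ Submodule.span K (Set.range (KaehlerDifferential.D L K)) := by
      rw [KaehlerDifferential.span_range_derivation]; trivial
    rw [Set.range_eq_singleton_iff.mpr h, Submodule.span_zero_singleton] at hw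
    exact hw
  have : IsPurelyInseparable L K := by
    rw [isPurelyInseparable_iff_pow_mem L p]
    intro x
    exact ⟨1, ⟨_, L.algebraMap_mem ⟨x ^ p, ⟨x, rfl⟩⟩⟩, by simp⟩
  have h := Algebra.FormallyUnramified.range_eq_top_of_isPurelyInseparable L K
  rw [eq_top_iff]
  intro x _
  obtain ⟨y, rfl⟩ := (h ▸ Subring.mem_top x : x ∈ (algebraMap L K).range)
  exact y.2

/-- Suppose that `d t` generates the differentials of `K` over the perfect field `k` of
characteristic `p`, and let `D` be the derivation `d / d t`. Then every element killed by `D` is a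
`p`-th power: it is a polynomial in `t` of degree less than `p` with coefficients in `K ^ p`. -/
theorem exists_pow_eq_of_derivation_eq_zero [Algebra.EssFiniteType k K] {t : K}
    {D : Derivation k K K} (hDt : D t = 1)
    (hD : ∀ a : K, KaehlerDifferential.D k K a = D a • KaehlerDifferential.D k K t)
    {a : K} (ha : D a = 0) : ∃ b : K, b ^ p = a := by
  have : CharP K p := charP_of_injective_algebraMap (algebraMap k K).injective p
  let F := powField k K p
  have hpF : CharP F p := charP_of_injective_algebraMap (algebraMap k F).injective p
  have hpos := (Fact.out : p.Prime).pos
  have hpow (b : K) : D (b ^ p) = 0 := by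
    rw [Derivation.leibniz_pow, ← Nat.cast_smul_eq_nsmul K, CharP.cast_eq_zero, zero_smul]
  -- `D` is linear over `K ^ p`
  let D' : Derivation F K K := Derivation.mk'
    { toFun := D
      map_add' := map_add D
      map_smul' := by
        rintro ⟨_, b, rfl⟩ x
        change D (b ^ p * x) = b ^ p * D x
        rw [Derivation.leibniz, hpow, smul_zero, add_zero, smul_eq_mul] }
    (fun x y ↦ D.leibniz x y)
  have htop := adjoin_powField_eq_top p t (fun a ↦ ⟨D a, hD a⟩)
  have hint : IsIntegral F t :=
    .of_pow hpos (isIntegral_algebraMap (x := (⟨t ^ p, t, rfl⟩ : F)))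
  have hmem : a ∈ Algebra.adjoin F {t} := by
    rw [← IntermediateField.adjoin_simple_toSubalgebra_of_isAlgebraic hint.isAlgebraic, htop]
    trivial
  rw [Algebra.adjoin_singleton_eq_range_aeval] at hmem
  obtain ⟨f, rfl⟩ := hmem
  change D (Polynomial.aeval t f) = 0 at ha
  change ∃ b : K, b ^ p = Polynomial.aeval t f
  -- reduce the polynomial modulo `X ^ p - t ^ p`
  let q : Polynomial F := Polynomial.X ^ p - Polynomial.C ⟨t ^ p, t, rfl⟩
  have hq : q.Monic := Polynomial.monic_X_pow_sub_C _ hpos.ne'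
  have hqt : Polynomial.aeval t q = 0 := by
    simp only [q, map_sub, map_pow, Polynomial.aeval_X, Polynomial.aeval_C]
    exact sub_self _
  rw [← Polynomial.aeval_modByMonic_eq_self_of_root hqt] at ha ⊢
  set g := f %ₘ q
  have hgdeg : g.natDegree < p := by
    have h1 : q.natDegree = p := Polynomial.natDegree_X_pow_sub_C
    have := Polynomial.natDegree_modByMonic_lt f hq (fun h ↦ by
      rw [h, Polynomial.natDegree_one] at h1; exact hpos.ne h1)
    rwa [h1] at this
  have hiter (n : ℕ) :
      D^[n] (Polynomial.aeval t g) = Polynomial.aeval t (Polynomial.derivative^[n] g) := by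
    induction n with
    | zero => rfl
    | succ n ih =>
      rw [Function.iterate_succ_apply', Function.iterate_succ_apply', ih]
      have := D'.map_aeval (Polynomial.derivative^[n] g) t
      refine this.trans ?_
      change _ • D t = _
      rw [hDt, smul_eq_mul, mul_one]
  by_cases hn : g.natDegree = 0
  · rw [Polynomial.eq_C_of_natDegree_eq_zero hn, Polynomial.aeval_C]
    exact (g.coeff 0).2
  · exfalso
    obtain ⟨m, hm⟩ := Nat.exists_eq_succ_of_ne_zero hn
    have h0 : D^[g.natDegree] (Polynomial.aeval t g) = 0 := by
      rw [hm, Nat.succ_eq_add_one, Function.iterate_succ_apply, ha]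
      exact Function.iterate_fixed (map_zero D) m
    -- the top derivative of `g` is the constant `n! c`, with `c` the leading coefficient
    have hconst : Polynomial.derivative^[g.natDegree] g =
        Polynomial.C ((g.natDegree.factorial : F) * g.leadingCoeff) := by
      have hd : (Polynomial.derivative^[g.natDegree] g).natDegree = 0 := by
        have := Polynomial.natDegree_iterate_derivative g g.natDegree
        omega
      rw [Polynomial.eq_C_of_natDegree_eq_zero hd, Polynomial.coeff_iterate_derivative, zero_add,
        Nat.descFactorial_self, nsmul_eq_mul]
      rfl
    rw [hiter, hconst, Polynomial.aeval_C, map_eq_zero, mul_eq_zero,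
      Polynomial.leadingCoeff_eq_zero] at h0
    rcases h0 with h0 | h0
    · rw [CharP.cast_eq_zero_iff F p, (Fact.out : p.Prime).dvd_factorial] at h0
      omega
    · exact hn (by rw [h0, Polynomial.natDegree_zero])

end Constants

/-! ### Eigenvectors of an additive map with `Θ ^ p = Θ` -/

section Eigen

variable {G : Type*} [AddCommGroup G] (p : ℕ) [Fact p.Prime]

open Polynomial in
/-- The projector onto the eigenspace of `-j` is `1 - (T + j) ^ (p - 1)`. -/
theorem exists_eigenvector_sum_of_module [Module (ZMod p) G] (T : Module.End (ZMod p) G)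
    (hΘ : ∀ x, T^[p] x = T x) (x : G) :
    ∃ y : ZMod p → G, (∀ j, T (y j) + j.val • y j = 0) ∧ ∑ j, y j = x := by
  have hT (n : ℕ) (y : G) : (T ^ n) y = T^[n] y := Module.End.pow_apply T n y
  let P (j : ZMod p) : (ZMod p)[X] := 1 - (X + C j) ^ (p - 1)
  have hpp : p - 1 + 1 = p := Nat.sub_add_cancel (Fact.out : p.Prime).one_le
  refine ⟨fun j ↦ aeval T (P j) x, fun j ↦ ?_, ?_⟩
  · have h1 : (X + C j) * P j = X - X ^ p := by
      have : (X + C j) ^ p = X ^ p + C j := by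
        rw [add_pow_char, ← C_pow, ZMod.pow_card]
      calc (X + C j) * P j = (X + C j) - (X + C j) ^ (p - 1 + 1) := by ring
        _ = X - X ^ p := by rw [hpp, this]; ring
    have h2 := congrArg (fun q ↦ aeval T q x) h1
    simp only [map_mul, map_add, map_sub, map_pow, aeval_X, aeval_C, Module.End.mul_apply,
      LinearMap.add_apply, LinearMap.sub_apply, Module.algebraMap_end_apply, hT, hΘ] at h2
    have h3 : j.val • aeval T (P j) x = j • aeval T (P j) x := by
      rw [← Nat.cast_smul_eq_nsmul (ZMod p), ZMod.natCast_zmod_val]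
    rw [h3]
    exact h2.trans (sub_self _)
  · have h1 : ∑ j, P j = 1 := by
      refine sub_eq_zero.mp (eq_zero_of_natDegree_lt_card_of_eval_eq_zero _
        (f := fun i : ZMod p ↦ i) Function.injective_id (fun i ↦ ?_) ?_)
      · rw [eval_sub, eval_finsetSum, eval_one, Finset.sum_eq_single (-i)]
        · have : p - 1 ≠ 0 := by have := (Fact.out : p.Prime).two_le; omega
          simp [P, this]
        · intro j _ hj
          have : i + j ≠ 0 := fun h ↦ hj (by linear_combination h)
          simp [P, ZMod.pow_card_sub_one_eq_one this]
        · simp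
      · rw [ZMod.card]
        have h2 : (∑ j, P j - 1).natDegree ≤ p - 1 := by
          refine (natDegree_sub_le _ _).trans (max_le ?_ (by simp))
          refine natDegree_sum_le_of_forall_le _ _ fun j _ ↦ ?_
          refine (natDegree_sub_le _ _).trans (max_le (by simp) ?_)
          exact (natDegree_pow_le_of_le _ (natDegree_X_add_C j).le).trans (mul_one _).le
        have := (Fact.out : p.Prime).pos
        omega
    have h2 := congrArg (fun q ↦ aeval T q x) h1
    simpa using h2

/-- If `p` kills `G` and `Θ ^ p = Θ`, then `G` is spanned by the eigenvectors of `Θ` with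
eigenvalues in `𝔽_p`. -/
theorem exists_eigenvector_sum (hp : ∀ x : G, p • x = 0) (Θ : G →+ G)
    (hΘ : ∀ x, Θ^[p] x = Θ x) (x : G) :
    ∃ y : ZMod p → G, (∀ j, Θ (y j) + j.val • y j = 0) ∧ ∑ j, y j = x := by
  let _ : Module (ZMod p) G := AddCommGroup.zmodModule hp
  exact exists_eigenvector_sum_of_module p (Θ.toZModLinearMap p) hΘ x

end Eigen

/-! ### Bases over the dual numbers -/

section DualBasis

variable {ι A M : Type*} [Fintype ι] [CommRing A] [AddCommGroup M] [Module A M]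

theorem EpsExt.fst_sum_smul (x : ι → A[ε]) (g : ι → EpsExt M) :
    fst (∑ i, x i • g i) = ∑ i, (x i).fst • fst (g i) := by
  simp

/-- Vectors of `M[ε]` which reduce to a basis of `M` generate `M[ε]`. -/
theorem EpsExt.exists_eq_sum_smul (b : Module.Basis ι A M) {g : ι → EpsExt M}
    (hg : ∀ i, fst (g i) = b i) (m : EpsExt M) : ∃ x : ι → A[ε], m = ∑ i, x i • g i := by
  let a : ι → A := fun i ↦ b.repr (fst m) i
  let a' : ι → A := fun i ↦ b.repr (snd m - ∑ i, a i • snd (g i)) i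
  refine ⟨fun i ↦ TrivSqZeroExt.inl (a i) + TrivSqZeroExt.inr (a' i), EpsExt.ext ?_ ?_⟩
  · rw [fst_sum_smul]
    simp only [hg, TrivSqZeroExt.fst_add, TrivSqZeroExt.fst_inl, TrivSqZeroExt.fst_inr, add_zero]
    exact (b.sum_repr (fst m)).symm
  · have h := b.sum_repr (snd m - ∑ i, a i • snd (g i))
    rw [map_sum]
    simp only [EpsExt.snd_smul, hg, TrivSqZeroExt.fst_add, TrivSqZeroExt.fst_inl,
      TrivSqZeroExt.fst_inr, TrivSqZeroExt.snd_add, TrivSqZeroExt.snd_inl, TrivSqZeroExt.snd_inr,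
      add_zero, zero_add]
    rw [Finset.sum_add_distrib, h]
    abel

/-- Vectors of `M[ε]` which reduce to linearly independent vectors are linearly independent. -/
theorem EpsExt.eq_zero_of_sum_smul_eq_zero {v : ι → EpsExt M}
    (hv : LinearIndependent A fun i ↦ fst (v i)) {x : ι → A[ε]} (h : ∑ i, x i • v i = 0) (i : ι) :
    x i = 0 := by
  rw [Fintype.linearIndependent_iff] at hv
  have h1 := hv (fun i ↦ (x i).fst) (by rw [← fst_sum_smul, h, map_zero])
  have h2 := hv (fun i ↦ (x i).snd) (by
    have := congrArg snd h
    rw [map_sum] at this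
    simpa [h1] using this)
  exact TrivSqZeroExt.ext (h1 i) (h2 i)

end DualBasis

/-! ### Bases over a semiring -/

section SemiringBasis

theorem exists_basis_of_unique_sum {ι S H : Type*} [Fintype ι] [Semiring S] [AddCommMonoid H]
    [Module S H] (e : ι → H) (hinj : ∀ c c' : ι → S, ∑ i, c i • e i = ∑ i, c' i • e i → c = c')
    (hsurj : ∀ m : H, ∃ c : ι → S, ∑ i, c i • e i = m) :
    ∃ b : Module.Basis ι S H, ∀ i, b i = e i := by
  classical
  let f : (ι → S) →ₗ[S] H := Fintype.linearCombination S e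
  let F : (ι → S) ≃ₗ[S] H := LinearEquiv.ofBijective f ⟨fun c c' h ↦ hinj c c' h, hsurj⟩
  refine ⟨.ofEquivFun F.symm, fun i ↦ ?_⟩
  rw [Module.Basis.coe_ofEquivFun, LinearEquiv.symm_symm]
  change f (Pi.single i 1) = e i
  simp [f, Fintype.linearCombination_apply_single]

end SemiringBasis

/-! ### Horizontal sections in terms of eigenvectors -/

section Coordinate

/-- `t` is a coordinate on the curve with function field `K`, and `D` is the derivation
`d / d t`. -/
structure IsCoordinate {k K : Type*} [CommRing k] [CommRing K] [Algebra k K]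
    (D : Derivation k K K) (t : K) : Prop where
  apply_self : D t = 1
  D_eq (a : K) : KaehlerDifferential.D k K a = D a • KaehlerDifferential.D k K t

variable {k K : Type*} [Field k] [Field K] [Algebra k K] {D : Derivation k K K} {t : K}

theorem IsCoordinate.ne_zero (h : IsCoordinate D t) : t ≠ 0 := by
  rintro rfl
  simpa using h.apply_self

theorem IsCoordinate.mul_apply_pow (h : IsCoordinate D t) (n : ℕ) :
    t * D (t ^ n) = n * t ^ n := by
  rcases n with _ | n
  · simp
  · rw [Derivation.leibniz_pow, h.apply_self]
    simp only [Nat.add_sub_cancel, smul_eq_mul, mul_one, nsmul_eq_mul]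
    ring

theorem IsCoordinate.exists_eq_pow_mul_pow {p : ℕ} [Fact p.Prime] [CharP k p] [PerfectRing k p]
    [Algebra.EssFiniteType k K] (h : IsCoordinate D t) {n : ℕ} {a : K} (ha : t * D a = n * a) :
    ∃ b : K, a = t ^ n * b ^ p := by
  have ht : t ^ (n + 1) ≠ 0 := pow_ne_zero _ h.ne_zero
  obtain ⟨c, rfl⟩ : ∃ c, a = t ^ n * c :=
    ⟨a / t ^ n, (mul_div_cancel₀ a (pow_ne_zero n h.ne_zero)).symm⟩
  have hc : t ^ (n + 1) * D c = 0 := by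
    have h1 := h.mul_apply_pow n
    rw [Derivation.leibniz, smul_eq_mul, smul_eq_mul] at ha
    linear_combination ha - c * h1
  obtain ⟨b, rfl⟩ := exists_pow_eq_of_derivation_eq_zero p h.apply_self h.D_eq
    ((mul_eq_zero.mp hc).resolve_left ht)
  exact ⟨b, rfl⟩

theorem inl_smul_dualDerivation (t : K) (D : Derivation k K K) :
    (TrivSqZeroExt.inl t : K[ε]) • dualDerivation D = dualDerivation (t • D) := by
  ext x
  · simp
  · simp

theorem isUnit_inl (ht : t ≠ 0) : IsUnit (TrivSqZeroExt.inl t : K[ε]) :=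
  (isUnit_iff_ne_zero.mpr ht).map (TrivSqZeroExt.inlHom K K)

variable {V : Type*} [AddCommGroup V] [Module K V]

/-- A section of `E[ε]` is horizontal if its derivative along `t d / d t` vanishes. -/
theorem IsCoordinate.toFun_eq_zero_iff (h : IsCoordinate D t)
    (nabla : Connection k[ε] K[ε] (EpsExt V)) (m : EpsExt V) :
    nabla.toFun m = 0 ↔ nabla.covDeriv (dualDerivation (t • D)) m = 0 := by
  rw [nabla.toFun_eq_zero_iff (isUnit_inl h.ne_zero) (D_dual_eq_smul h.D_eq),
    inl_smul_dualDerivation]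

theorem IsCoordinate.iterate_covDeriv_eq {p : ℕ} [Fact p.Prime] [CharP k p]
    (h : IsCoordinate D t) {nabla : Connection k[ε] K[ε] (EpsExt V)}
    (hcurv : nabla.HasVanishingPCurvature p) (m : EpsExt V) :
    (nabla.covDeriv (dualDerivation (t • D)))^[p] m =
      nabla.covDeriv (dualDerivation (t • D)) m := by
  rw [← inl_smul_dualDerivation]
  refine hcurv.iterate_covDeriv_eq (D_dual_eq_smul h.D_eq) ?_ m
  refine TrivSqZeroExt.ext ?_ ?_
  · simpa using h.apply_self
  · simp

theorem Connection.sum_smul_eq_zero_of_covDeriv {ι B A M : Type*} [Fintype ι] [CommRing B]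
    [CommRing A] [Algebra B A] [AddCommGroup M] [Module A M] (nabla : Connection B A M)
    {θ : Derivation B A A} {v : ι → M} {n : ι → ℕ}
    (hv : ∀ i, nabla.covDeriv θ (v i) + n i • v i = 0) {x : ι → A}
    (hx : nabla.covDeriv θ (∑ i, x i • v i) = 0) :
    ∑ i, (θ (x i) - n i * x i) • v i = 0 := by
  rw [← hx, map_sum]
  refine Finset.sum_congr rfl fun i _ ↦ ?_
  rw [nabla.covDeriv_leibniz, eq_neg_of_add_eq_zero_left (hv i), sub_smul, mul_comm, mul_smul,
    Nat.cast_smul_eq_nsmul, smul_neg]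
  abel

/-- Data describing `E[ε]` on an open set with ring of functions `A` and module of sections `M`:
vectors `g i` of `M[ε]` reducing to a basis of `M`, on which the derivative along `t d / d t` has
eigenvalues `-n i`. The last condition says that `c` is in `A` as soon as `t ^ (n i) c ^ p` is; it
holds if `A` is normal, `t` vanishes at most at one point and only to first order, and `n i < p`.
-/
structure EigenFrame {ι A M : Type*} [CommRing A] [Algebra k A] [AddCommGroup M] [Module A M]
    (p : ℕ) (nabla : Connection k[ε] K[ε] (EpsExt V)) (D : Derivation k K K) (t : K)
    (φ : A →ₐ[k] K) (ψ : M →+ V) (b : Module.Basis ι A M) (g : ι → EpsExt M) (n : ι → ℕ) (τ : A) :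
    Prop where
  injective : Function.Injective φ
  fst_eq (i : ι) : EpsExt.fst (g i) = b i
  eigen (i : ι) : nabla.covDeriv (dualDerivation (t • D)) (EpsExt.map ψ (g i)) +
    n i • EpsExt.map ψ (g i) = 0
  linearIndependent : LinearIndependent K fun i ↦ ψ (b i)
  map_eq : φ τ = t
  root (i : ι) (a : A) (c : K) : φ a = t ^ n i * c ^ p → ∃ c₁ : A, φ c₁ = c

variable {ι A M : Type*} [Fintype ι] [CommRing A] [Algebra k A] [AddCommGroup M] [Module A M]
  {p : ℕ} [Fact p.Prime] [CharP k p]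
  {nabla : Connection k[ε] K[ε] (EpsExt V)} {φ : A →ₐ[k] K} {ψ : M →+ V}
  {b : Module.Basis ι A M} {g : ι → EpsExt M} {n : ι → ℕ} {τ : A}

/-- The element `a ^ p + a' ^ p ε` of the image of Frobenius. -/
def powDual (k : Type*) {A : Type*} [CommRing k] [CommRing A] [Algebra k A] (p : ℕ) (a a' : A) :
    frobeniusImage p k[ε] A[ε] :=
  ⟨TrivSqZeroExt.inl a ^ p, Algebra.subset_adjoin ⟨_, rfl⟩⟩ +
    algebraMap k[ε] (frobeniusImage p k[ε] A[ε]) ε *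
      ⟨TrivSqZeroExt.inl a' ^ p, Algebra.subset_adjoin ⟨_, rfl⟩⟩

theorem fst_dualAlgHom (φ : A →ₐ[k] K) (x : A[ε]) : (dualAlgHom φ x).fst = φ x.fst := rfl

theorem snd_dualAlgHom (φ : A →ₐ[k] K) (x : A[ε]) : (dualAlgHom φ x).snd = φ x.snd := rfl

theorem inl_pow_eq (a : A) (n : ℕ) : (TrivSqZeroExt.inl a : A[ε]) ^ n = TrivSqZeroExt.inl (a ^ n) :=
  (map_pow (TrivSqZeroExt.inlHom A A) a n).symm

omit [Fact p.Prime] [CharP k p] in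
theorem coe_powDual (a a' : A) :
    (powDual k p a a' : A[ε]) = TrivSqZeroExt.inl (a ^ p) + TrivSqZeroExt.inr (a' ^ p) := by
  have : (powDual k p a a' : A[ε]) = TrivSqZeroExt.inl a ^ p +
    algebraMap k[ε] A[ε] ε * TrivSqZeroExt.inl a' ^ p := rfl
  rw [this, ← eps_eq_algebraMap, inl_pow_eq a p, inl_pow_eq a' p]
  exact TrivSqZeroExt.ext (by simp) (by simp)

namespace EigenFrame

section Sum

variable (hψ : ∀ (a : A) (m : M), ψ (a • m) = φ a • ψ m)

/-- A shortcut instance: the general search goes through the ring structures of `A[ε]`. -/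
instance horizontalEpsModule :
    Module (frobeniusImage p k[ε] A[ε]) (nabla.horizontalEps p φ ψ hψ) := Submodule.module _

/-- A shortcut instance, see `horizontalEpsModule`. -/
instance horizontalEpsSMul :
    SMul (frobeniusImage p k[ε] A[ε]) (nabla.horizontalEps p φ ψ hψ) :=
  (horizontalEpsModule hψ).toSMul

omit [Fact p.Prime] in
theorem coe_sum_smul (c : ι → frobeniusImage p k[ε] A[ε]) (e : ι → nabla.horizontalEps p φ ψ hψ) :
    ((∑ i, c i • e i : nabla.horizontalEps p φ ψ hψ) : EpsExt M) =
      ∑ i, (c i : A[ε]) • (e i : EpsExt M) := by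
  simp only [AddSubmonoidClass.coe_finsetSum, SetLike.val_smul, Subalgebra.smul_def]

end Sum

variable (F : EigenFrame p nabla D t φ ψ b g n τ) (h : IsCoordinate D t)
  (hψ : ∀ (a : A) (m : M), ψ (a • m) = φ a • ψ m)
include F h

omit [Fintype ι] [Fact p.Prime] in
theorem smul_mem_horizontal (i : ι) :
    (TrivSqZeroExt.inl (τ ^ n i) : A[ε]) • g i ∈ nabla.horizontalEps p φ ψ hψ := by
  change nabla.toFun (EpsExt.map ψ _) = 0
  rw [h.toFun_eq_zero_iff, EpsExt.map_smul hψ, nabla.covDeriv_leibniz,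
    eq_neg_of_add_eq_zero_left (F.eigen i)]
  have h1 : dualAlgHom φ (TrivSqZeroExt.inl (τ ^ n i)) = TrivSqZeroExt.inl (t ^ n i) :=
    TrivSqZeroExt.ext (by rw [← F.map_eq, ← map_pow]; rfl) (map_zero φ)
  have h2 : dualDerivation (t • D) (TrivSqZeroExt.inl (t ^ n i)) =
      (n i : K[ε]) * TrivSqZeroExt.inl (t ^ n i) := by
    have := h.mul_apply_pow (n i)
    refine TrivSqZeroExt.ext ?_ ?_
    · simpa [-Derivation.leibniz_pow] using this
    · simp
  rw [h1, h2, mul_comm, mul_smul, smul_neg, Nat.cast_smul_eq_nsmul, neg_add_cancel]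

variable [PerfectRing k p] [Algebra.EssFiniteType k K]

omit [Fintype ι] in
theorem exists_root (i : ι) (a : A) (ha : t * D (φ a) = n i * φ a) :
    ∃ c : A, a = τ ^ n i * c ^ p := by
  obtain ⟨c, hc⟩ := h.exists_eq_pow_mul_pow (p := p) ha
  obtain ⟨c, rfl⟩ := F.root i a c hc
  exact ⟨c, F.injective (by rw [hc, map_mul, map_pow, map_pow, F.map_eq])⟩

/-- The horizontal sections of `M[ε]` are the combinations of the `t ^ (n i) g i` with coefficients
in the image of Frobenius. -/
theorem exists_eq_sum {m : EpsExt M} (hm : m ∈ nabla.horizontalEps p φ ψ hψ) :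
    ∃ c c' : ι → A, m = ∑ i, (powDual k p (c i) (c' i) : A[ε]) •
      (TrivSqZeroExt.inl (τ ^ n i) : A[ε]) • g i := by
  obtain ⟨x, rfl⟩ := EpsExt.exists_eq_sum_smul b F.fst_eq m
  change nabla.toFun (EpsExt.map ψ _) = 0 at hm
  rw [h.toFun_eq_zero_iff, map_sum] at hm
  simp only [EpsExt.map_smul hψ] at hm
  have h0 := EpsExt.eq_zero_of_sum_smul_eq_zero
    (v := fun i ↦ EpsExt.map ψ (g i)) (by simpa [F.fst_eq] using F.linearIndependent)
    (nabla.sum_smul_eq_zero_of_covDeriv F.eigen hm)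
  have h1 (i : ι) : t * D (φ (x i).fst) = n i * φ (x i).fst := by
    have := congrArg TrivSqZeroExt.fst (h0 i)
    simpa [sub_eq_zero, fst_dualAlgHom] using this
  have h2 (i : ι) : t * D (φ (x i).snd) = n i * φ (x i).snd := by
    have := congrArg TrivSqZeroExt.snd (h0 i)
    simpa [sub_eq_zero, snd_dualAlgHom] using this
  choose c hc using fun i ↦ F.exists_root h i _ (h1 i)
  choose c' hc' using fun i ↦ F.exists_root h i _ (h2 i)
  refine ⟨c, c', Finset.sum_congr rfl fun i _ ↦ ?_⟩
  rw [coe_powDual, smul_smul]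
  congr 1
  exact TrivSqZeroExt.ext (by simp [hc, mul_comm]) (by simp [hc', mul_comm])

theorem exists_basis (e : ι → nabla.horizontalEps p φ ψ hψ)
    (he : ∀ i, (e i : EpsExt M) = (TrivSqZeroExt.inl (τ ^ n i) : A[ε]) • g i) :
    ∃ B : Module.Basis ι (frobeniusImage p k[ε] A[ε]) (nabla.horizontalEps p φ ψ hψ),
      ∀ i, B i = e i := by
  refine exists_basis_of_unique_sum e (fun c c' hc ↦ funext fun i ↦ ?_) ?_
  · have h1 : ∑ i, ((c i : A[ε]) - c' i) • (e i : EpsExt M) = 0 := by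
      simp only [sub_smul, Finset.sum_sub_distrib]
      rw [← coe_sum_smul, ← coe_sum_smul, hc, sub_self]
    have h2 := congrArg (EpsExt.map ψ) h1
    simp only [map_sum, map_zero, he, smul_smul, EpsExt.map_smul hψ] at h2
    have h3 := EpsExt.eq_zero_of_sum_smul_eq_zero
      (v := fun i ↦ EpsExt.map ψ (g i)) (by simpa [F.fst_eq] using F.linearIndependent) h2 i
    have h4 : dualAlgHom φ (TrivSqZeroExt.inl (τ ^ n i)) = TrivSqZeroExt.inl (t ^ n i) :=
      TrivSqZeroExt.ext (by rw [← F.map_eq, ← map_pow]; rfl) (map_zero φ)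
    rw [map_mul, h4, (isUnit_inl (pow_ne_zero _ h.ne_zero)).mul_left_eq_zero, map_sub,
      sub_eq_zero] at h3
    exact Subtype.ext (TrivSqZeroExt.ext (F.injective (congrArg TrivSqZeroExt.fst h3))
      (F.injective (congrArg TrivSqZeroExt.snd h3)))
  · rintro ⟨m, hm⟩
    obtain ⟨c, c', hcc⟩ := F.exists_eq_sum h hψ hm
    refine ⟨fun i ↦ powDual k p (c i) (c' i), Subtype.ext ?_⟩
    rw [coe_sum_smul]
    simp only [he]
    exact hcc.symm

theorem bijective_horizontalQuotientMap :
    Function.Bijective (nabla.horizontalQuotientMap p φ ψ hψ) := by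
  constructor
  · rw [injective_iff_map_eq_zero]
    intro q
    induction q using QuotientAddGroup.induction_on with | H m => ?_
    intro hq
    rw [QuotientAddGroup.eq_zero_iff]
    obtain ⟨m, hm⟩ := m
    obtain ⟨c, c', rfl⟩ := F.exists_eq_sum h hψ hm
    have hfst := congrArg Subtype.val hq
    change EpsExt.fst _ = 0 at hfst
    rw [EpsExt.fst_sum_smul] at hfst
    have hb := Fintype.linearIndependent_iff.mp b.linearIndependent
      (fun i ↦ c i ^ p * τ ^ n i) (by
        rw [← hfst]
        exact Finset.sum_congr rfl fun i _ ↦ by simp [coe_powDual, F.fst_eq, mul_smul])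
    have hc (i : ι) : c i ^ p = 0 := by
      have := congrArg φ (hb i)
      rw [map_mul, map_pow φ τ, F.map_eq, map_zero] at this
      refine F.injective (((mul_eq_zero.mp this).resolve_right ?_).trans (map_zero φ).symm)
      exact pow_ne_zero _ h.ne_zero
    refine ⟨∑ i, powDual k p (c' i) 0 • ⟨_, F.smul_mem_horizontal h hψ i⟩, Subtype.ext ?_⟩
    change algebraMap k[ε] A[ε] ε • ((∑ i, powDual k p (c' i) 0 •
      (⟨_, F.smul_mem_horizontal h hψ i⟩ : nabla.horizontalEps p φ ψ hψ) :
        nabla.horizontalEps p φ ψ hψ) : EpsExt M) = _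
    rw [coe_sum_smul]
    rw [Finset.smul_sum, ← eps_eq_algebraMap]
    refine Finset.sum_congr rfl fun i _ ↦ ?_
    rw [smul_smul, smul_smul, smul_smul]
    congr 1
    have hp0 : (0 : A) ^ p = 0 := zero_pow (Fact.out : p.Prime).ne_zero
    exact TrivSqZeroExt.ext (by simp [coe_powDual, hc]) (by simp [coe_powDual, hp0])
  · rintro ⟨m₀, hm₀⟩
    have hred (i : ι) : nabla.reduction.covDeriv (t • D) (ψ (b i)) + n i • ψ (b i) = 0 := by
      have h1 := congrArg EpsExt.fst (F.eigen i)
      rw [map_add, ← nabla.reduction_covDeriv_fst, map_zero, map_nsmul, EpsExt.fst_map,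
        F.fst_eq] at h1
      exact h1
    have hm₁ : nabla.reduction.covDeriv (t • D) (∑ i, φ (b.repr m₀ i) • ψ (b i)) = 0 := by
      have : ∑ i, φ (b.repr m₀ i) • ψ (b i) = ψ m₀ := by
        conv_rhs => rw [← b.sum_repr m₀]
        simp only [map_sum, hψ]
      rw [this]
      change contract _ (nabla.reduction.toFun (ψ m₀)) = 0
      rw [show nabla.reduction.toFun (ψ m₀) = 0 from hm₀, map_zero]
    have h0 := Fintype.linearIndependent_iff.mp F.linearIndependent _
      (nabla.reduction.sum_smul_eq_zero_of_covDeriv hred hm₁)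
    choose c hc using fun i ↦ F.exists_root h i _ (sub_eq_zero.mp (h0 i))
    refine ⟨QuotientAddGroup.mk (∑ i, powDual k p (c i) 0 •
      (⟨_, F.smul_mem_horizontal h hψ i⟩ : nabla.horizontalEps p φ ψ hψ)), Subtype.ext ?_⟩
    change EpsExt.fst ((∑ i, powDual k p (c i) 0 •
      (⟨_, F.smul_mem_horizontal h hψ i⟩ : nabla.horizontalEps p φ ψ hψ) :
        nabla.horizontalEps p φ ψ hψ) : EpsExt M) = m₀
    rw [coe_sum_smul]
    rw [EpsExt.fst_sum_smul]
    conv_rhs => rw [← b.sum_repr m₀]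
    refine Finset.sum_congr rfl fun i _ ↦ ?_
    rw [hc i, coe_powDual, EpsExt.fst_smul, F.fst_eq, smul_smul]
    simp [mul_comm]

end EigenFrame

end Coordinate

/-! ### Eigenframes at a point -/

section Local

variable {k K V R N : Type u} [Field k] [Field K] [Algebra k K] [AddCommGroup V] [Module K V]
  [CommRing R] [AddCommGroup N] [Module R N] {D : Derivation k K K} {t : K}
  {nabla : Connection k[ε] K[ε] (EpsExt V)} {φ : R →+* K} {ψ : N →+ V}

/-- If `t ∇` is regular, and `d / d t` preserves the local ring, the derivative along `t d / d t`
preserves the module of regular sections. -/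
theorem covDeriv_mem_range_of_regularForms (hψ : ∀ (a : R) (m : N), ψ (a • m) = φ a • ψ m)
    (hD : ∀ a : R, ∃ a' : R, D (φ a) = φ a') {s : EpsExt V}
    (hs : (TrivSqZeroExt.inl t : K[ε]) • nabla.toFun s ∈
      regularForms k[ε] (dualMap φ) (EpsExt.map ψ)) :
    nabla.covDeriv (dualDerivation (t • D)) s ∈ (EpsExt.map ψ).range := by
  have h (w) (hw : w ∈ regularForms k[ε] (dualMap φ) (EpsExt.map ψ)) :
      contract (dualDerivation D) w ∈ (EpsExt.map ψ).range := by
    induction hw using AddSubgroup.closure_induction with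
    | mem w hw =>
      obtain ⟨b, s, rfl⟩ := hw
      obtain ⟨a, ha⟩ := hD b.fst
      obtain ⟨a', ha'⟩ := hD b.snd
      rw [contract_D_tmul]
      refine ⟨EpsExt.mk (a • EpsExt.fst s) (a • EpsExt.snd s + a' • EpsExt.fst s),
        EpsExt.ext ?_ ?_⟩
      · simp only [EpsExt.fst_map, EpsExt.fst_mk, hψ, EpsExt.fst_smul, fst_dualDerivation, ← ha]
        rfl
      · simp only [EpsExt.snd_map, EpsExt.fst_map, EpsExt.snd_mk, hψ, EpsExt.snd_smul, map_add,
          fst_dualDerivation, snd_dualDerivation, ← ha, ← ha']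
        rfl
    | zero => rw [map_zero]; exact zero_mem _
    | add x y _ _ hx hy => rw [map_add]; exact add_mem hx hy
    | neg x _ hx => rw [map_neg]; exact neg_mem hx
  have h1 := h _ hs
  rw [map_smul, ← contract_smul_left, inl_smul_dualDerivation] at h1
  exact h1

/-- A lattice in `V[ε]` preserved by an additive map `Θ` with `Θ ^ p = Θ` has a basis of
eigenvectors: it is spanned by eigenvectors, and a basis may be chosen among the elements of a
generating set over a local ring. -/
theorem exists_eigenbasis [IsLocalRing R] (p : ℕ) [Fact p.Prime] (hpV : ∀ v : V, p • v = 0)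
    {r : ℕ} (b₀ : Module.Basis (Fin r) R N) (hinj : Function.Injective ψ)
    {Θ : EpsExt V →+ EpsExt V} (hp : ∀ s, Θ^[p] s = Θ s)
    (hreg : ∀ s, Θ (EpsExt.map ψ s) ∈ (EpsExt.map ψ).range) :
    ∃ (b : Module.Basis (Fin r) R N) (g : Fin r → EpsExt N) (n : Fin r → ℕ),
      ∀ i, n i < p ∧ EpsExt.fst (g i) = b i ∧
        Θ (EpsExt.map ψ (g i)) + n i • EpsExt.map ψ (g i) = 0 := by
  let S := (EpsExt.map ψ).range
  have hS : ∀ s : S, Θ s ∈ S := by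
    rintro ⟨_, s, rfl⟩
    exact hreg s
  let Θ' : S →+ S := (Θ.comp S.subtype).codRestrict S hS
  have hiter (m : ℕ) (s : S) : ((Θ'^[m] s : S) : EpsExt V) = Θ^[m] s := by
    induction m with
    | zero => rfl
    | succ m ih => rw [Function.iterate_succ_apply', Function.iterate_succ_apply', ← ih]; rfl
  have hpS (s : S) : p • s = 0 :=
    Subtype.ext (EpsExt.ext (by simpa using hpV _) (by simpa using hpV _))
  let I := {g : EpsExt N // ∃ n < p, Θ (EpsExt.map ψ g) + n • EpsExt.map ψ g = 0}
  let v : I → N := fun g ↦ EpsExt.fst g.1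
  have hspan : Submodule.span R (Set.range v) = ⊤ := by
    rw [eq_top_iff]
    intro m _
    obtain ⟨y, hy, hsum⟩ := exists_eigenvector_sum p hpS Θ'
      (fun s ↦ Subtype.ext (by rw [hiter]; exact hp s)) ⟨_, EpsExt.inl m, rfl⟩
    choose g hg using fun j ↦ (y j).2
    have hm : m = ∑ j, EpsExt.fst (g j) := by
      refine hinj ?_
      have := congrArg (fun s : S ↦ EpsExt.fst s.1) hsum
      simp only [AddSubmonoidClass.coe_finsetSum, map_sum, ← hg] at this
      rw [map_sum]
      exact this.symm
    rw [hm]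
    refine Submodule.sum_mem _ fun j _ ↦ Submodule.subset_span ⟨⟨g j, j.val, j.val_lt, ?_⟩, rfl⟩
    rw [hg]
    exact congrArg Subtype.val (hy j)
  have : Module.Free R N := .of_basis b₀
  have : Module.Finite R N := .of_basis b₀
  have : Module.FinitePresentation R N := Module.finitePresentation_of_projective R N
  obtain ⟨κ, a, b, hb⟩ := Module.exists_basis_of_span_of_flat v hspan
  let e : κ ≃ Fin r := b.indexEquiv b₀
  refine ⟨b.reindex e, fun i ↦ (a (e.symm i)).1, fun i ↦ (a (e.symm i)).2.choose, fun i ↦ ?_⟩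
  refine ⟨(a (e.symm i)).2.choose_spec.1, ?_, (a (e.symm i)).2.choose_spec.2⟩
  rw [Module.Basis.reindex_apply, hb]

end Local

/-! ### Local rings of smooth curves at rational points -/

section LocalRing

variable {k R : Type u} [Field k] [CommRing R] [Algebra k R] [IsLocalRing R]

/-- If `Ω` is free of rank one over a local ring with residue field `k`, it has a basis `d t` with
`t` in the maximal ideal. -/
theorem exists_maximalIdeal_basis_D
    (hres : ∀ a : R, ∃ c : k, a - algebraMap k R c ∈ IsLocalRing.maximalIdeal R)
    (b : Module.Basis Unit R Ω[R⁄k]) :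
    ∃ t ∈ IsLocalRing.maximalIdeal R, ∃ b' : Module.Basis Unit R Ω[R⁄k],
      b' () = KaehlerDifferential.D k R t := by
  have hb (w : Ω[R⁄k]) : b.coord () w • b () = w := by
    simpa using b.sum_repr w
  -- otherwise all differentials would be multiples of `b` with coefficient in the maximal ideal
  obtain ⟨t, ht, hu⟩ : ∃ t ∈ IsLocalRing.maximalIdeal R,
      IsUnit (b.coord () (KaehlerDifferential.D k R t)) := by
    by_contra! hcon
    have h1 (w : Ω[R⁄k]) : b.coord () w ∈ IsLocalRing.maximalIdeal R := by
      have hw : w ∈ Submodule.span R (Set.range (KaehlerDifferential.D k R)) := by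
        rw [KaehlerDifferential.span_range_derivation]; trivial
      induction hw using Submodule.span_induction with
      | mem x h =>
        obtain ⟨a, rfl⟩ := h
        obtain ⟨c, hc⟩ := hres a
        have := hcon _ hc
        rw [map_sub, Derivation.map_algebraMap, sub_zero] at this
        exact (IsLocalRing.mem_maximalIdeal _).mpr this
      | zero => simp
      | add x y _ _ hx hy => rw [map_add]; exact add_mem hx hy
      | smul a x _ hx => rw [map_smul]; exact Ideal.mul_mem_left _ _ hx
    have h2 := h1 (b ())
    rw [b.coord_apply, b.repr_self, Finsupp.single_eq_same] at h2
    exact (Ideal.ne_top_iff_one _).mp Ideal.IsPrime.ne_top' h2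
  refine ⟨t, ht, b.unitsSMul fun _ ↦ hu.unit, ?_⟩
  rw [Module.Basis.unitsSMul_apply]
  exact hb _

/-- If moreover the maximal ideal is finitely generated, it is generated by `t`: the derivation
`a ↦ a - a(x)` to the cotangent space factors through `Ω = R dt`, so the class of `t` spans the
cotangent space. -/
theorem maximalIdeal_eq_span_singleton
    (hres : ∀ a : R, ∃ c : k, a - algebraMap k R c ∈ IsLocalRing.maximalIdeal R)
    (hfg : (IsLocalRing.maximalIdeal R).FG) {t : R} (ht : t ∈ IsLocalRing.maximalIdeal R)
    (hD : ∀ a : R, ∃ c : R, KaehlerDifferential.D k R a = c • KaehlerDifferential.D k R t) :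
    IsLocalRing.maximalIdeal R = Ideal.span {t} := by
  set m := IsLocalRing.maximalIdeal R
  have huniq {c c' : k} {a : R} (h : a - algebraMap k R c ∈ m) (h' : a - algebraMap k R c' ∈ m) :
      c = c' := by
    by_contra hne
    have h1 : algebraMap k R (c - c') ∈ m := by
      have := sub_mem h' h
      rwa [sub_sub_sub_cancel_left, ← map_sub] at this
    exact (IsLocalRing.mem_maximalIdeal _).mp h1
      ((isUnit_iff_ne_zero.mpr (sub_ne_zero.mpr hne)).map (algebraMap k R))
  choose σ hσ using hres
  have hσ_add (a b : R) : σ (a + b) = σ a + σ b := huniq (hσ _) (by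
    have := add_mem (hσ a) (hσ b)
    rwa [← add_sub_add_comm, ← map_add] at this)
  have hσ_alg (c : k) : σ (algebraMap k R c) = c := huniq (hσ _) (by simp)
  have hσ_mul (a b : R) : σ (a * b) = σ a * σ b := huniq (hσ _) (by
    have := add_mem (m.mul_mem_left a (hσ b)) (m.mul_mem_left (algebraMap k R (σ b)) (hσ a))
    convert! this using 1
    rw [map_mul]
    ring)
  let δ : Derivation k R m.Cotangent :=
    { toFun := fun a ↦ m.toCotangent ⟨_, hσ a⟩
      map_add' := fun a b ↦ by
        rw [← map_add]
        congr 1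
        refine Subtype.ext ?_
        change a + b - algebraMap k R (σ (a + b)) = _
        rw [hσ_add, map_add]
        exact add_sub_add_comm _ _ _ _
      map_smul' := fun c a ↦ by
        rw [RingHom.id_apply, algebra_compatible_smul R c (m.toCotangent _), ← map_smul]
        congr 1
        refine Subtype.ext ?_
        change c • a - algebraMap k R (σ (c • a)) = algebraMap k R c * (a - algebraMap k R (σ a))
        rw [Algebra.smul_def, hσ_mul, hσ_alg, map_mul]
        ring
      map_one_eq_zero' := by
        change m.toCotangent ⟨1 - algebraMap k R (σ 1), _⟩ = 0
        rw [Ideal.toCotangent_eq_zero]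
        have : σ 1 = 1 := by rw [← hσ_alg 1, map_one]
        simp [this]
      leibniz' := fun a b ↦ by
        change m.toCotangent ⟨a * b - algebraMap k R (σ (a * b)), _⟩ =
          a • m.toCotangent ⟨_, hσ b⟩ + b • m.toCotangent ⟨_, hσ a⟩
        rw [← map_smul, ← map_smul, ← map_add, Ideal.toCotangent_eq]
        -- the difference is minus the product of `a - a(x)` and `b - b(x)`
        have := neg_mem (Ideal.mul_mem_mul (hσ a) (hσ b))
        rw [← pow_two] at this
        convert! this using 1
        change a * b - algebraMap k R (σ (a * b)) -
          (a * (b - algebraMap k R (σ b)) + b * (a - algebraMap k R (σ a))) = _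
        rw [hσ_mul, map_mul]
        ring }
  have hδ (a : R) (ha : a ∈ m) : δ a = m.toCotangent ⟨a, ha⟩ := by
    change m.toCotangent _ = _
    congr 1
    refine Subtype.ext ?_
    change a - algebraMap k R (σ a) = a
    have : σ a = 0 := huniq (hσ a) (by simpa using ha)
    rw [this, map_zero, sub_zero]
  refine le_antisymm ?_ ((Ideal.span_singleton_le_iff_mem _).mpr ht)
  refine Submodule.le_of_le_smul_of_le_jacobson_bot hfg (IsLocalRing.maximalIdeal_le_jacobson ⊥) ?_
  intro a ha
  obtain ⟨c, hc⟩ := hD a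
  have h1 := congrArg δ.liftKaehlerDifferential hc
  rw [map_smul, Derivation.liftKaehlerDifferential_comp_D,
    Derivation.liftKaehlerDifferential_comp_D, hδ a ha, hδ t ht, ← map_smul,
    Ideal.toCotangent_eq] at h1
  have h2 : a = c * t + (a - c * t) := by ring
  rw [h2]
  refine Submodule.add_mem_sup (Ideal.mul_mem_left _ _ (Ideal.mem_span_singleton_self t)) ?_
  rw [smul_eq_mul, ← pow_two]
  exact h1

/-- A regular local ring of dimension one and its coordinate: let `R` be a Noetherian local domain
with residue field `k` and fraction field `K`, such that `Ω` is free of rank one over `R`. Then `R`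
is a discrete valuation ring, and a uniformizer `t` is a coordinate such that `d / d t` preserves
`R`. -/
theorem exists_isCoordinate [IsDomain R] [IsNoetherianRing R] {K : Type u} [Field K] [Algebra k K]
    [Algebra R K] [IsScalarTower k R K] [IsFractionRing R K]
    (hres : ∀ a : R, ∃ c : k, a - algebraMap k R c ∈ IsLocalRing.maximalIdeal R)
    (b : Module.Basis Unit R Ω[R⁄k]) :
    IsDiscreteValuationRing R ∧ ∃ (t : R) (D : Derivation k K K),
      IsLocalRing.maximalIdeal R = Ideal.span {t} ∧ IsCoordinate D (algebraMap R K t) ∧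
        ∀ a : R, ∃ a' : R, D (algebraMap R K a) = algebraMap R K a' := by
  obtain ⟨t, ht, b, hbt⟩ := exists_maximalIdeal_basis_D hres b
  have hb (w : Ω[R⁄k]) : b.repr w () • KaehlerDifferential.D k R t = w := by
    simpa [hbt] using b.sum_repr w
  have hspan := maximalIdeal_eq_span_singleton hres (IsNoetherian.noetherian _) ht
    (fun a ↦ ⟨_, (hb _).symm⟩)
  have hfield : ¬ IsField R := by
    intro hf
    rw [(IsLocalRing.isField_iff_maximalIdeal_eq).mp hf] at ht
    exact b.ne_zero () (hbt.trans (by rw [(Submodule.mem_bot R).mp ht, map_zero]))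
  have hprin : (IsLocalRing.maximalIdeal R).IsPrincipal := ⟨t, hspan⟩
  refine ⟨((IsDiscreteValuationRing.TFAE R hfield).out 0 4).mpr hprin, t, ?_⟩
  have : Algebra.FormallyEtale R K := .of_isLocalization (nonZeroDivisors R)
  have hbc : IsBaseChange K (KaehlerDifferential.map k k R K) :=
    KaehlerDifferential.isBaseChange_of_formallyEtale k R K
  let f : Ω[R⁄k] →ₗ[R] K := (Algebra.linearMap R K).comp (b.coord ())
  let D : Derivation k K K := (hbc.lift f).compDer (KaehlerDifferential.D k K)
  have hDR (a : R) :
      D (algebraMap R K a) = algebraMap R K (b.repr (KaehlerDifferential.D k R a) ()) := by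
    change hbc.lift f (KaehlerDifferential.D k K (algebraMap R K a)) = _
    rw [← KaehlerDifferential.map_D k k R K, hbc.lift_eq]
    rfl
  refine ⟨D, hspan, ⟨?_, fun a ↦ ?_⟩, fun a ↦ ⟨_, hDR a⟩⟩
  · rw [hDR, ← hbt, b.repr_self, Finsupp.single_eq_same, map_one]
  · change _ = hbc.lift f (KaehlerDifferential.D k K a) • _
    generalize KaehlerDifferential.D k K a = w
    induction w using hbc.inductionOn with
    | zero => simp
    | tmul w =>
      rw [hbc.lift_eq]
      conv_lhs => rw [← hb w]
      rw [map_smul, KaehlerDifferential.map_D]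
      exact algebra_compatible_smul K _ _
    | smul c w h => rw [map_smul, smul_assoc, ← h]
    | add x y hx hy => rw [map_add, add_smul, ← hx, ← hy]

end LocalRing

/-! ### Points of a smooth proper curve -/

section Points

variable {k : Type u} [Field k] (C : SmoothProperCurve k)

/-- The structure of `k`-algebra on the local rings of a curve. -/
instance stalkAlgebra (x : C.X) : Algebra k (C.X.presheaf.stalk x) :=
  ((C.X.presheaf.germ ⊤ x trivial).hom.comp (algebraMap k Γ(C.X, ⊤))).toAlgebra

theorem germ_algebraMap (U : C.X.Opens) (x : C.X) (hx : x ∈ U) (c : k) :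
    C.X.presheaf.germ U x hx (algebraMap k Γ(C.X, U) c) =
      algebraMap k (C.X.presheaf.stalk x) c := by
  have h (V : C.X.Opens) (hV : x ∈ V) := ConcreteCategory.congr_hom
    (C.X.presheaf.germ_res (homOfLE le_top) x hV)
    ((C.str.appTop.hom.comp (Scheme.ΓSpecIso (.of k)).inv.hom) c)
  exact (h U hx).trans (h ⊤ trivial).symm

theorem stalkToK_germ (x : C.X) (U : C.X.Opens) [Nonempty U] (hx : x ∈ U) (a : Γ(C.X, U)) :
    stalkToK C x (C.X.presheaf.germ U x hx a) = toK C U a :=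
  Scheme.algebraMap_germ_eq_germToFunctionField (X := C.X) hx a

theorem stalkToK_eq_algebraMap (x : C.X) :
    stalkToK C x = algebraMap (C.X.presheaf.stalk x) C.K := rfl

instance (x : C.X) : IsScalarTower k (C.X.presheaf.stalk x) C.K :=
  .of_algebraMap_eq fun c ↦ by
    have : Nonempty (⊤ : C.X.Opens) := ⟨⟨x, trivial⟩⟩
    exact (stalkToK_germ C x ⊤ trivial (algebraMap k Γ(C.X, ⊤) c)).symm

theorem stalkToK_injective (x : C.X) : Function.Injective (stalkToK C x) :=
  IsFractionRing.injective (C.X.presheaf.stalk x) C.X.functionField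

theorem toK_injective (U : C.X.Opens) [Nonempty U] : Function.Injective (toK C U) :=
  Scheme.germToFunctionField_injective C.X U

instance : IsLocallyNoetherian C.X :=
  haveI : Smooth C.str := SmoothOfRelativeDimension.smooth 1 C.str
  LocallyOfFiniteType.isLocallyNoetherian C.str

instance : JacobsonSpace C.X :=
  haveI : Smooth C.str := SmoothOfRelativeDimension.smooth 1 C.str
  LocallyOfFiniteType.jacobsonSpace C.str

/-- Every point of a curve has an affine neighbourhood whose ring is standard smooth over `k`. -/
theorem exists_isStandardSmooth (x : C.X) : ∃ U : C.X.Opens, IsAffineOpen U ∧ x ∈ U ∧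
    Algebra.IsStandardSmoothOfRelativeDimension 1 k Γ(C.X, U) := by
  obtain ⟨V, hV, U, hU, hx, e, h⟩ :=
    SmoothOfRelativeDimension.exists_isStandardSmoothOfRelativeDimension (n := 1) (f := C.str) x
  refine ⟨U, hU, hx, ?_⟩
  have hV' : V = ⊤ := by
    have hs : Subsingleton (Spec (.of k)) := inferInstanceAs (Subsingleton (PrimeSpectrum k))
    refine top_le_iff.mp fun y _ ↦ ?_
    rw [Subsingleton.elim y (C.str x)]
    exact e hx
  subst hV'
  have h1 := RingHom.isStandardSmoothOfRelativeDimension_respectsIso.2 (C.str.appLE ⊤ U e).hom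
    (Scheme.ΓSpecIso (.of k)).symm.commRingCatIsoToRingEquiv h
  exact h1

theorem fromSpecStalk_str (x : C.X) : C.X.fromSpecStalk x ≫ C.str =
    Spec.map (CommRingCat.ofHom (algebraMap k (C.X.presheaf.stalk x))) := by
  have h1 : C.str = C.X.toSpecΓ ≫ Spec.map ((Scheme.ΓSpecIso (.of k)).inv ≫ C.str.appTop) := by
    rw [Spec.map_comp, ← Scheme.toSpecΓ_naturality_assoc, toSpecΓ_SpecMap_ΓSpecIso_inv,
      Category.comp_id]
  have h2 : CommRingCat.ofHom (algebraMap k (C.X.presheaf.stalk x)) =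
      ((Scheme.ΓSpecIso (.of k)).inv ≫ C.str.appTop) ≫ C.X.presheaf.germ ⊤ x trivial := by
    ext c
    exact (ConcreteCategory.congr_hom
      (C.X.presheaf.germ_res (homOfLE le_top : (⊤ : C.X.Opens) ⟶ ⊤) x trivial)
      ((C.str.appTop.hom.comp (Scheme.ΓSpecIso (.of k)).inv.hom) c))
  rw [h2, Spec.map_comp, ← Scheme.fromSpecStalk_toSpecΓ, Category.assoc, ← h1]

/-- The residue field at a closed point is `k`. -/
theorem residue_surjective [IsAlgClosed k] (x : C.X) (hx : IsClosed {x})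
    (a : C.X.presheaf.stalk x) : ∃ c : k, a - algebraMap k (C.X.presheaf.stalk x) c ∈
      IsLocalRing.maximalIdeal (C.X.presheaf.stalk x) := by
  have : Smooth C.str := SmoothOfRelativeDimension.smooth 1 C.str
  have h1 : (residueFieldIsoBase C.str x hx).inv =
      CommRingCat.ofHom (algebraMap k (C.X.presheaf.stalk x)) ≫ C.X.residue x := by
    apply Spec.map_injective
    rw [SpecMap_residueFieldIsoBase_inv, Spec.map_comp, ← fromSpecStalk_str, ← Category.assoc]
    rfl
  refine ⟨(residueFieldIsoBase C.str x hx).hom (C.X.residue x a), ?_⟩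
  rw [← IsLocalRing.residue_eq_zero_iff, map_sub, sub_eq_zero]
  have h2 := ConcreteCategory.congr_hom h1
    ((residueFieldIsoBase C.str x hx).hom (C.X.residue x a))
  rw [← ConcreteCategory.comp_apply (residueFieldIsoBase C.str x hx).hom, Iso.hom_inv_id] at h2
  exact h2

theorem exists_basis_differentials (x : C.X) :
    Nonempty (Module.Basis Unit (C.X.presheaf.stalk x) Ω[C.X.presheaf.stalk x⁄k]) := by
  obtain ⟨U, hU, hx, h⟩ := exists_isStandardSmooth C x
  have : Nonempty U := ⟨⟨x, hx⟩⟩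
  let _ := C.X.presheaf.algebra_section_stalk (⟨x, hx⟩ : U)
  have hloc := hU.isLocalization_stalk ⟨x, hx⟩
  have : IsScalarTower k Γ(C.X, U) (C.X.presheaf.stalk x) :=
    .of_algebraMap_eq fun c ↦ (germ_algebraMap C U x hx c).symm
  have : Algebra.FormallyEtale Γ(C.X, U) (C.X.presheaf.stalk x) :=
    .of_isLocalization (hU.primeIdealOf ⟨x, hx⟩).asIdeal.primeCompl
  have hbc := KaehlerDifferential.isBaseChange_of_formallyEtale k Γ(C.X, U) (C.X.presheaf.stalk x)
  have : Algebra.IsStandardSmooth k Γ(C.X, U) := h.isStandardSmooth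
  have hrank : Module.finrank Γ(C.X, U) Ω[Γ(C.X, U)⁄k] = 1 :=
    Module.finrank_eq_of_rank_eq
      (Algebra.IsStandardSmoothOfRelativeDimension.rank_kaehlerDifferential 1)
  have b := Module.finBasisOfFinrankEq Γ(C.X, U) Ω[Γ(C.X, U)⁄k] hrank
  exact ⟨((Algebra.TensorProduct.basis (C.X.presheaf.stalk x) b).map hbc.equiv).reindex
    (Equiv.equivPUnit (Fin 1))⟩

theorem essFiniteType_functionField : Algebra.EssFiniteType k C.K := by
  obtain ⟨U, hU, hx, h⟩ := exists_isStandardSmooth C (genericPoint C.X)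
  have : Nonempty U := ⟨⟨_, hx⟩⟩
  have : IsScalarTower k Γ(C.X, U) C.K :=
    .of_algebraMap_eq fun c ↦ ((toK C U).commutes c).symm
  have : IsFractionRing Γ(C.X, U) C.K := functionField_isFractionRing_of_isAffineOpen C.X U hU
  have : Algebra.IsStandardSmooth k Γ(C.X, U) := h.isStandardSmooth
  have : Algebra.EssFiniteType Γ(C.X, U) C.K := .of_isLocalization _ (nonZeroDivisors Γ(C.X, U))
  exact .comp k Γ(C.X, U) C.K

/-- The local ring at a closed point is a discrete valuation ring, and there is a uniformizer which
is a coordinate. -/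
theorem exists_isCoordinate_stalk [IsAlgClosed k] (x : C.X) (hx : IsClosed {x}) :
    IsDiscreteValuationRing (C.X.presheaf.stalk x) ∧
      ∃ (t : C.X.presheaf.stalk x) (D : Derivation k C.K C.K),
        IsLocalRing.maximalIdeal (C.X.presheaf.stalk x) = Ideal.span {t} ∧
          IsCoordinate D (stalkToK C x t) ∧
            ∀ a, ∃ a', D (stalkToK C x a) = stalkToK C x a' :=
  let ⟨b⟩ := exists_basis_differentials C x
  exists_isCoordinate (residue_surjective C x hx) b

end Points

/-! ### Restriction, germs and trivializations -/

section Restriction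

variable {X : Scheme.{u}} (E : X.Modules)

/-- Restriction of functions from `V` to a smaller open set `U`. -/
def resO {U V : X.Opens} (h : U ≤ V) : Γ(X, V) →+* Γ(X, U) :=
  (X.presheaf.map (homOfLE h).op).hom

theorem res_smul {U V : X.Opens} (h : U ≤ V) (a : Γ(X, V)) (s : Γ(E, V)) :
    res E h (a • s) = resO h a • res E h s :=
  E.map_smul (homOfLE h) a s

theorem resO_resO {U V W : X.Opens} (h : U ≤ V) (h' : V ≤ W) (a : Γ(X, W)) :
    resO h (resO h' a) = resO (h.trans h') a :=
  (ConcreteCategory.congr_hom (X.presheaf.map_comp (homOfLE h').op (homOfLE h).op) a).symm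

theorem germ_resO {U V : X.Opens} (h : U ≤ V) (x : X) (hx : x ∈ U) (a : Γ(X, V)) :
    X.presheaf.germ U x hx (resO h a) = X.presheaf.germ V x (h hx) a :=
  X.presheaf.germ_res_apply (homOfLE h) x hx a

theorem germ_res {U V : X.Opens} (h : U ≤ V) (x : X) (hx : x ∈ U) (s : Γ(E, V)) :
    E.presheaf.germ U x hx (res E h s) = E.presheaf.germ V x (h hx) s :=
  E.presheaf.germ_res_apply (homOfLE h) x hx s

theorem res_res {U V W : X.Opens} (h : U ≤ V) (h' : V ≤ W) (s : Γ(E, W)) :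
    res E h (res E h' s) = res E (h.trans h') s := by
  have := ConcreteCategory.congr_hom
    (E.presheaf.map_comp (homOfLE h').op (homOfLE h).op) s
  exact this.symm

theorem map_res_inl_smul {U V : X.Opens} (h : U ≤ V) (a : Γ(X, V)) (m : EpsExt Γ(E, V)) :
    EpsExt.map (res E h) ((TrivSqZeroExt.inl a : Γ(X, V)[ε]) • m) =
      (TrivSqZeroExt.inl (resO h a) : Γ(X, U)[ε]) • EpsExt.map (res E h) m :=
  EpsExt.ext (by simp [res_smul]) (by simp [res_smul])

variable {E}

/-- Finitely many germs of functions come from sections on a common open set. -/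
theorem exists_germ_family {r : ℕ} {x : X} {U : X.Opens} (hx : x ∈ U)
    (c : Fin r → X.presheaf.stalk x) :
    ∃ (V : X.Opens) (hV : x ∈ V), V ≤ U ∧ ∃ a : Fin r → Γ(X, V),
      ∀ i, X.presheaf.germ V x hV (a i) = c i := by
  choose V hVU hV a ha using fun i ↦ X.presheaf.exists_le_germ_eq (c i) hx
  have hmem : x ∈ (⨅ i, V i) ⊓ U :=
    ⟨by rw [Opens.coe_iInf]; exact Set.mem_iInter.mpr hV, hx⟩
  refine ⟨(⨅ i, V i) ⊓ U, hmem, inf_le_right,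
    fun i ↦ resO (inf_le_left.trans (iInf_le _ i)) (a i), fun i ↦ ?_⟩
  rw [germ_resO, ← ha i]

/-- Finitely many germs of sections of `E` come from sections on a common open set. -/
theorem exists_germ_family_modules {r : ℕ} {x : X} {U : X.Opens} (hx : x ∈ U)
    (c : Fin r → E.presheaf.stalk x) :
    ∃ (V : X.Opens) (hV : x ∈ V), V ≤ U ∧ ∃ a : Fin r → Γ(E, V),
      ∀ i, E.presheaf.germ V x hV (a i) = c i := by
  choose V hVU hV a ha using fun i ↦ E.presheaf.exists_le_germ_eq (c i) hx
  have hmem : x ∈ (⨅ i, V i) ⊓ U :=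
    ⟨by rw [Opens.coe_iInf]; exact Set.mem_iInter.mpr hV, hx⟩
  refine ⟨(⨅ i, V i) ⊓ U, hmem, inf_le_right,
    fun i ↦ res E (inf_le_left.trans (iInf_le _ i)) (a i), fun i ↦ ?_⟩
  rw [germ_res, ← ha i]

/-- The sections `e` of `E` on `U` restrict to a basis of the sections on every open subset. -/
def Trivializes {r : ℕ} {U : X.Opens} (e : Fin r → Γ(E, U)) : Prop :=
  ∀ (W : X.Opens) (hW : W ≤ U), ∃ b : Module.Basis (Fin r) Γ(X, W) Γ(E, W),
    ∀ i, b i = res E hW (e i)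

theorem Trivializes.exists_stalk_basis {r : ℕ} {U : X.Opens} {e : Fin r → Γ(E, U)}
    (he : Trivializes e) (x : X) (hx : x ∈ U) :
    ∃ b : Module.Basis (Fin r) (X.presheaf.stalk x) (E.presheaf.stalk x),
      ∀ i, b i = E.presheaf.germ U x hx (e i) := by
  have hsum {W : X.Opens} (hW : W ≤ U) (hxW : x ∈ W) (a : Fin r → Γ(X, W)) :
      E.presheaf.germ W x hxW (∑ i, a i • res E hW (e i)) =
        ∑ i, X.presheaf.germ W x hxW (a i) •
          (E.presheaf.germ U x hx (e i) : E.presheaf.stalk x) := by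
    refine (map_sum (E.presheaf.germ W x hxW).hom _ _).trans ?_
    exact Finset.sum_congr rfl fun i _ ↦ by
      rw [← germ_res E hW x hxW]; exact germ_smul E W x hxW _ _
  have hli : LinearIndependent (X.presheaf.stalk x)
      (fun i ↦ (E.presheaf.germ U x hx (e i) : E.presheaf.stalk x)) := by
    rw [Fintype.linearIndependent_iff]
    intro c hc i
    obtain ⟨V, hV, hVU, a, ha⟩ := exists_germ_family hx c
    simp only [← ha] at hc
    rw [← hsum hVU hV] at hc
    obtain ⟨W, hxW, i₁, i₂, h⟩ := E.presheaf.germ_eq x hV hV _ 0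
      (hc.trans (map_zero (E.presheaf.germ V x hV).hom).symm)
    have h1 : res E i₁.le (∑ i, a i • res E hVU (e i)) = 0 := h.trans (map_zero (res E i₂.le))
    rw [map_sum] at h1
    simp only [res_smul, res_res] at h1
    obtain ⟨b, hb⟩ := he W (i₁.le.trans hVU)
    simp only [← hb] at h1
    have h2 := Fintype.linearIndependent_iff.mp b.linearIndependent _ h1 i
    rw [← ha i, ← germ_resO i₁.le x hxW, h2, map_zero]
  have hsp : ⊤ ≤ Submodule.span (X.presheaf.stalk x)
      (Set.range fun i ↦ (E.presheaf.germ U x hx (e i) : E.presheaf.stalk x)) := by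
    intro s _
    obtain ⟨V, hVU, hV, s, rfl⟩ := E.presheaf.exists_le_germ_eq s hx
    obtain ⟨b, hb⟩ := he V hVU
    have h1 : s = ∑ i, b.repr s i • res E hVU (e i) := by
      conv_lhs => rw [← b.sum_repr s]
      simp only [hb]
    rw [h1, hsum hVU hV]
    exact Submodule.sum_mem _ fun i _ ↦ Submodule.smul_mem _ _ (Submodule.subset_span ⟨i, rfl⟩)
  exact ⟨.mk hli hsp, fun i ↦ Module.Basis.mk_apply hli hsp i⟩

/-- Compatibility of determinants of families of vectors with extension of scalars. -/
theorem map_basis_det {A B M N ι : Type*} [Fintype ι] [DecidableEq ι] [CommRing A] [CommRing B]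
    [AddCommGroup M] [AddCommGroup N] [Module A M] [Module B N] (f : A →+* B) (g : M →+ N)
    (hg : ∀ (a : A) (m : M), g (a • m) = f a • g m) (b : Module.Basis ι A M)
    (b' : Module.Basis ι B N) (hb : ∀ i, b' i = g (b i)) (v : ι → M) :
    b'.det (fun i ↦ g (v i)) = f (b.det v) := by
  rw [Module.Basis.det_apply, Module.Basis.det_apply, RingHom.map_det]
  congr 1
  ext i j
  have h : g (v j) = ∑ i, f (b.repr (v j) i) • b' i := by
    conv_lhs => rw [← b.sum_repr (v j)]
    simp only [map_sum, hg, hb]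
  rw [Module.Basis.toMatrix_apply, h, b'.repr_sum_self]
  rfl

/-- Sections whose germs at `x` form a basis trivialize `E` near `x`: where their determinant is
invertible. -/
theorem Trivializes.exists_of_stalk_basis {r : ℕ} {U : X.Opens} {e : Fin r → Γ(E, U)}
    (he : Trivializes e) {x : X} {V : X.Opens} (hx : x ∈ V) (hVU : V ≤ U) (s : Fin r → Γ(E, V))
    (b : Module.Basis (Fin r) (X.presheaf.stalk x) (E.presheaf.stalk x))
    (hb : ∀ i, b i = E.presheaf.germ V x hx (s i)) :
    ∃ (V' : X.Opens) (h : V' ≤ V), x ∈ V' ∧ Trivializes fun i ↦ res E h (s i) := by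
  obtain ⟨bx, hbx⟩ := he.exists_stalk_basis x (hVU hx)
  obtain ⟨bV, hbV⟩ := he V hVU
  have h1 : bx.det b = X.presheaf.germ V x hx (bV.det s) := by
    have h2 : ⇑b = fun i ↦ (E.presheaf.germ V x hx).hom (s i) := funext hb
    rw [h2]
    refine map_basis_det (X.presheaf.germ V x hx).hom (E.presheaf.germ V x hx).hom
      (germ_smul E V x hx) bV bx (fun i ↦ ?_) s
    rw [hbx, hbV]
    exact (germ_res E hVU x hx (e i)).symm
  refine ⟨X.basicOpen (bV.det s), X.basicOpen_le _, ?_, fun W hW ↦ ?_⟩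
  · rw [Scheme.mem_basicOpen X _ x hx, ← h1]
    exact bx.isUnit_det b
  · have hWV := hW.trans (X.basicOpen_le (bV.det s))
    obtain ⟨bW, hbW⟩ := he W (hWV.trans hVU)
    have h2 : IsUnit (bW.det fun i ↦ res E hWV (s i)) := by
      rw [map_basis_det (resO hWV) (res E hWV) (res_smul E hWV) bV bW (fun i ↦ by
        rw [hbW, hbV, res_res])]
      have h3 := (X.toRingedSpace.isUnit_res_basicOpen (bV.det s)).map (resO hW)
      rw [← resO_resO hW (X.basicOpen_le (bV.det s))]
      exact h3
    obtain ⟨hli, hsp⟩ := (bW.is_basis_iff_det).mpr h2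
    refine ⟨.mk hli hsp.ge, fun i ↦ ?_⟩
    rw [Module.Basis.mk_apply, res_res]

end Restriction

/-! ### Rational functions regular at the closed points -/

section Regular

variable {k : Type u} [Field k] (C : SmoothProperCurve k)

theorem toK_resO {U V : C.X.Opens} [Nonempty U] [Nonempty V] (h : U ≤ V) (a : Γ(C.X, V)) :
    toK C U (resO h a) = toK C V a :=
  germ_resO h (genericPoint C.X) (generic_mem C U) a

theorem toGeneric_res {E : C.X.Modules} {U V : C.X.Opens} [Nonempty U] [Nonempty V] (h : U ≤ V)
    (s : Γ(E, V)) : toGeneric E U (res E h s) = toGeneric E V s :=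
  germ_res E h (genericPoint C.X) (generic_mem C U) s

theorem stalkToGeneric_germ {E : C.X.Modules} (x : C.X) (U : C.X.Opens) [Nonempty U] (hx : x ∈ U)
    (s : Γ(E, U)) : stalkToGeneric E x (E.presheaf.germ U x hx s) = toGeneric E U s :=
  E.presheaf.germ_stalkSpecializes_apply hx (generic_specializes C x) s

theorem stalkToGeneric_smul (E : C.X.Modules) (x : C.X) (a : C.X.presheaf.stalk x)
    (s : E.presheaf.stalk x) :
    stalkToGeneric E x (a • s) = stalkToK C x a • stalkToGeneric E x s := by
  obtain ⟨U, hU, a, rfl⟩ := C.X.presheaf.exists_germ_eq a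
  obtain ⟨V, hVU, hV, s, rfl⟩ := E.presheaf.exists_le_germ_eq s hU
  have : Nonempty U := ⟨⟨x, hU⟩⟩
  have : Nonempty V := ⟨⟨x, hV⟩⟩
  rw [stalkToGeneric_germ, stalkToK_germ, ← germ_resO hVU x hV a, ← germ_smul,
    stalkToGeneric_germ, toGeneric_smul, toK_resO]

/-- Every point of an open set specializes to a closed point of the curve in that open set. -/
theorem exists_closedPoint {W : C.X.Opens} {y : C.X} (hy : y ∈ W) :
    ∃ z ∈ W, IsClosed {z} ∧ y ⤳ z := by
  have hlc : IsLocallyClosed (closure {y} ∩ (W : Set C.X)) :=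
    isClosed_closure.isLocallyClosed.inter W.isOpen.isLocallyClosed
  obtain ⟨z, ⟨hz, hzW⟩, hzc⟩ := nonempty_inter_closedPoints
    (Z := closure {y} ∩ (W : Set C.X)) ⟨y, subset_closure rfl, hy⟩ hlc
  exact ⟨z, hzW, hzc, specializes_iff_mem_closure.mpr hz⟩

/-- A rational function which is regular at all closed points of `W` is a function on `W`. -/
theorem exists_toK_eq {W : C.X.Opens} [Nonempty W] {f : C.K}
    (hf : ∀ z ∈ W, IsClosed {z} → ∃ a, stalkToK C z a = f) : ∃ a, toK C W a = f := by
  have h (y : W) : ∃ (V : C.X.Opens) (_ : Nonempty V), y.1 ∈ V ∧ V ≤ W ∧ ∃ a, toK C V a = f := by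
    obtain ⟨z, hzW, hz, hyz⟩ := exists_closedPoint C y.2
    obtain ⟨a, ha⟩ := hf z hzW hz
    obtain ⟨V, hVW, hV, a, rfl⟩ := C.X.presheaf.exists_le_germ_eq a hzW
    have : Nonempty V := ⟨⟨z, hV⟩⟩
    exact ⟨V, this, hyz.mem_open V.isOpen hV, hVW, a, by rw [← ha, stalkToK_germ]⟩
  choose V hne hmem hle a ha using h
  obtain ⟨s, hs, -⟩ := C.X.sheaf.existsUnique_gluing' V W (fun y ↦ homOfLE (hle y))
    (fun y hy ↦ Opens.mem_iSup.mpr ⟨⟨y, hy⟩, hmem ⟨y, hy⟩⟩) a (fun y y' ↦ by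
      have hy := hne y
      have hy' := hne y'
      have hne' : Nonempty (V y ⊓ V y' : C.X.Opens) :=
        ⟨⟨_, generic_mem C (V y), generic_mem C (V y')⟩⟩
      apply toK_injective C (V y ⊓ V y')
      exact (toK_resO C inf_le_left (a y)).trans
        (((ha y).trans (ha y').symm).trans (toK_resO C inf_le_right (a y')).symm))
  refine ⟨s, ?_⟩
  obtain ⟨y⟩ := ‹Nonempty W›
  have hy := hne y
  rw [← ha y, ← toK_resO C (hle y) s]
  exact congrArg (toK C (V y)) (hs y)

/-- A uniformizer at a closed point is invertible away from that point on some neighbourhood. -/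
theorem exists_uniformizer_section {x : C.X} (hx : IsClosed {x}) {t : C.X.presheaf.stalk x}
    (ht : IsLocalRing.maximalIdeal (C.X.presheaf.stalk x) = Ideal.span {t}) :
    ∃ (U : C.X.Opens) (hxU : x ∈ U) (τ : Γ(C.X, U)), C.X.presheaf.germ U x hxU τ = t ∧
      ∀ (y : C.X) (hy : y ∈ U), y ≠ x → IsUnit (C.X.presheaf.germ U y hy τ) := by
  obtain ⟨A, hA, hxA, -⟩ := exists_isStandardSmooth C x
  obtain ⟨V, hVA, hV, τ, hτ⟩ := C.X.presheaf.exists_le_germ_eq t hxA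
  -- the ideal of `x` in the coordinate ring of an affine neighbourhood
  let I : Ideal Γ(C.X, A) := (IsLocalRing.maximalIdeal (C.X.presheaf.stalk x)).comap
    (C.X.presheaf.germ A x hxA).hom
  have : IsNoetherianRing Γ(C.X, A) := IsLocallyNoetherian.component_noetherian ⟨A, hA⟩
  obtain ⟨G, hG⟩ := IsNoetherian.noetherian I
  -- near `x`, all elements of `I` are multiples of `τ`
  have hdvd : ∀ g ∈ G, ∀ᶠ y in nhds x, ∀ (hy : y ∈ V),
      C.X.presheaf.germ V y hy τ ∣ C.X.presheaf.germ A y (hVA hy) g := by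
    intro g hg
    have hgI : g ∈ I := hG ▸ Submodule.subset_span hg
    have hgx : C.X.presheaf.germ A x hxA g ∈ Ideal.span {t} := ht ▸ hgI
    obtain ⟨c, hc⟩ := Ideal.mem_span_singleton.mp hgx
    obtain ⟨W, hWV, hW, c, rfl⟩ := C.X.presheaf.exists_le_germ_eq c hV
    have hne : Nonempty W := ⟨⟨x, hW⟩⟩
    have heq : resO (hWV.trans hVA) g = resO hWV τ * c := by
      refine germ_injective_of_isIntegral C.X x hW ?_
      rw [map_mul, germ_resO, germ_resO, hc, hτ]
    filter_upwards [W.isOpen.mem_nhds hW] with y hyW hyV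
    refine ⟨C.X.presheaf.germ W y hyW c, ?_⟩
    rw [← germ_resO (hWV.trans hVA) y hyW, heq, map_mul, germ_resO]
  obtain ⟨U₀, hU₀, hU₀o, hxU₀⟩ := mem_nhds_iff.mp ((Finset.eventually_all G).mpr hdvd)
  have hUV : V ⊓ ⟨U₀, hU₀o⟩ ≤ V := inf_le_left
  refine ⟨V ⊓ ⟨U₀, hU₀o⟩, ⟨hV, hxU₀⟩, resO hUV τ,
    (germ_resO hUV x ⟨hV, hxU₀⟩ τ).trans hτ, fun y hy hyx ↦ ?_⟩
  rw [germ_resO]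
  by_contra hnu
  have hyA : y ∈ A := hVA (hUV hy)
  have hnx : y ∈ (⟨{x}ᶜ, hx.isOpen_compl⟩ : C.X.Opens) := hyx
  obtain ⟨g, hg, hyg⟩ := hA.exists_basicOpen_le ⟨y, hnx⟩ hyA
  have hgI : g ∈ I := by
    refine (IsLocalRing.mem_maximalIdeal _).mpr fun hu ↦ ?_
    exact hg ((Scheme.mem_basicOpen C.X g x hxA).mpr hu) rfl
  have hle : I ≤ (Ideal.span {C.X.presheaf.germ V y (hUV hy) τ}).comap
      (C.X.presheaf.germ A y hyA).hom := by
    rw [← hG, Submodule.span_le]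
    intro g hg
    exact Ideal.mem_span_singleton.mpr (hU₀ hy.2 g hg (hUV hy))
  exact hnu (isUnit_of_dvd_unit (Ideal.mem_span_singleton.mp (hle hgI))
    ((Scheme.mem_basicOpen C.X g y hyA).mp hyg))

/-- Suppose that `t ^ n c ^ p` is regular on `W`, where `n < p` and `t` vanishes at most at `x`, to
first order. Then `c` is regular on `W`: away from `x` as the local rings are normal, and at `x` as
the valuation of `c` cannot be negative. -/
theorem exists_toK_eq_of_pow [IsAlgClosed k] {p n : ℕ} (hn : n < p) {x : C.X} (hx : IsClosed {x})
    {t : C.X.presheaf.stalk x}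
    (ht : IsLocalRing.maximalIdeal (C.X.presheaf.stalk x) = Ideal.span {t})
    {W : C.X.Opens} [Nonempty W] {τ : Γ(C.X, W)} (hτ : toK C W τ = stalkToK C x t)
    (hunit : ∀ (y : C.X) (hy : y ∈ W), y ≠ x → IsUnit (C.X.presheaf.germ W y hy τ))
    {a : Γ(C.X, W)} {c : C.K} (hac : toK C W a = stalkToK C x t ^ n * c ^ p) :
    ∃ c₁, toK C W c₁ = c := by
  refine exists_toK_eq C fun z hz hzc ↦ ?_
  have hp : 0 < p := by omega
  have hdvr := (exists_isCoordinate_stalk C z hzc).1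
  have hφ : stalkToK C z (C.X.presheaf.germ W z hz a) =
      stalkToK C z (C.X.presheaf.germ W z hz τ) ^ n * c ^ p := by
    rw [stalkToK_germ, stalkToK_germ, hτ, hac]
  by_cases hzx : z = x
  · subst hzx
    rcases ValuationRing.isInteger_or_isInteger (C.X.presheaf.stalk z) c with ⟨c₁, h⟩ | ⟨c₁, h⟩
    · exact ⟨c₁, h⟩
    change stalkToK C z c₁ = c⁻¹ at h
    by_cases hu : IsUnit c₁
    · obtain ⟨u, rfl⟩ := hu
      refine ⟨(u⁻¹ : (C.X.presheaf.stalk z)ˣ), ?_⟩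
      rw [map_units_inv, h, inv_inv]
    by_cases hc0 : c = 0
    · exact ⟨0, by rw [hc0, map_zero]⟩
    -- otherwise `1 / c` is a multiple of `t`, and `c ^ p` has a pole of order at least `p`
    exfalso
    have hc₁ : c₁ ∈ Ideal.span {t} := ht ▸ (IsLocalRing.mem_maximalIdeal c₁).mpr hu
    obtain ⟨d, rfl⟩ := Ideal.mem_span_singleton.mp hc₁
    have hgerm : C.X.presheaf.germ W z hz τ = t := stalkToK_injective C z (by
      rw [stalkToK_germ, hτ])
    have ht0 : t ≠ 0 := by
      rintro rfl
      rw [zero_mul, map_zero] at h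
      exact hc0 (inv_eq_zero.mp h.symm)
    have hcp : stalkToK C z (t * d) ^ p * c ^ p = 1 := by
      rw [h, ← mul_pow, inv_mul_cancel₀ hc0, one_pow]
    have h1 : t ^ n * (t ^ (p - n) * d ^ p * C.X.presheaf.germ W z hz a) = t ^ n := by
      apply stalkToK_injective C z
      have hpn : t ^ p = t ^ n * t ^ (p - n) := by rw [← pow_add]; congr 1; omega
      calc stalkToK C z (t ^ n * (t ^ (p - n) * d ^ p * C.X.presheaf.germ W z hz a))
          = stalkToK C z ((t * d) ^ p) * stalkToK C z (C.X.presheaf.germ W z hz a) := by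
            rw [← map_mul, mul_pow, hpn]; ring_nf
        _ = stalkToK C z t ^ n * (stalkToK C z (t * d) ^ p * c ^ p) := by
            rw [hφ, hgerm, map_pow]; ring
        _ = stalkToK C z (t ^ n) := by rw [hcp, mul_one, map_pow]
    have h2 := mul_left_cancel₀ (pow_ne_zero n ht0) (h1.trans (mul_one _).symm)
    have h3 : t ∣ 1 := by
      rw [← h2, mul_assoc]
      exact (dvd_pow_self t (by omega)).mul_right _
    have h4 : t ∈ IsLocalRing.maximalIdeal (C.X.presheaf.stalk z) :=
      ht ▸ Ideal.mem_span_singleton_self t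
    exact (IsLocalRing.mem_maximalIdeal t).mp h4 (isUnit_of_dvd_one h3)
  · obtain ⟨u, hu⟩ := hunit z hz hzx
    rw [← hu] at hφ
    have hint : IsIntegral (C.X.presheaf.stalk z) c := by
      refine IsIntegral.of_pow hp ?_
      have : c ^ p = algebraMap (C.X.presheaf.stalk z) C.K
          ((u⁻¹ : (C.X.presheaf.stalk z)ˣ) ^ n * C.X.presheaf.germ W z hz a) := by
        rw [← stalkToK_eq_algebraMap, map_mul, hφ, ← mul_assoc, map_pow, ← mul_pow, ← map_mul,
          Units.inv_mul, map_one, one_pow, one_mul]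
      rw [this]
      exact isIntegral_algebraMap
    exact IsIntegrallyClosed.isIntegral_iff.mp hint

end Regular

/-! ### Eigenframes near a closed point -/

section Global

variable {k : Type u} [Field k] {C : SmoothProperCurve k} {E : C.X.Modules}

theorem stalkToGeneric_injective {r : ℕ} (hE : IsVectorBundle E r) (x : C.X) :
    Function.Injective (stalkToGeneric E x) := by
  obtain ⟨U, hx, e, he⟩ := hE x
  have : Nonempty U := ⟨⟨x, hx⟩⟩
  obtain ⟨b, hb⟩ := Trivializes.exists_stalk_basis he x hx
  obtain ⟨b', hb'⟩ := Trivializes.exists_stalk_basis he _ (generic_mem C U)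
  have hbb (i : Fin r) : stalkToGeneric E x (b i) = b' i := by
    rw [hb, hb', stalkToGeneric_germ]; rfl
  rw [injective_iff_map_eq_zero]
  intro s hs
  rw [← b.sum_repr s, map_sum] at hs
  simp only [stalkToGeneric_smul, hbb] at hs
  have h := Fintype.linearIndependent_iff.mp b'.linearIndependent _ hs
  rw [← b.sum_repr s]
  refine Finset.sum_eq_zero fun i _ ↦ ?_
  rw [stalkToK_injective C x ((h i).trans (map_zero _).symm), zero_smul]

/-- Near a closed point, a logarithmic connection with vanishing `p`-curvature has an
eigenframe. -/
theorem exists_eigenFrame [IsAlgClosed k] {p : ℕ} [Fact p.Prime] [CharP k p] {r : ℕ}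
    (hE : IsVectorBundle E r) {nabla : RatConnectionEps E} (hlog : IsLogarithmicEps nabla)
    (hcurv : nabla.HasVanishingPCurvature p) {x : C.X} (hx : IsClosed {x}) :
    ∃ (U : C.X.Opens) (_ : x ∈ U) (t : C.K) (D : Derivation k C.K C.K) (_ : IsCoordinate D t)
      (g : Fin r → EpsExt Γ(E, U)) (n : Fin r → ℕ) (τ : Γ(C.X, U)),
      ∀ (W : C.X.Opens) [Nonempty W] (hW : W ≤ U), ∃ b : Module.Basis (Fin r) Γ(C.X, W) Γ(E, W),
        EigenFrame p nabla D t (toK C W) (toGeneric E W) b (fun i ↦ EpsExt.map (res E hW) (g i)) n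
          (resO hW τ) := by
  obtain ⟨U₀, hxU₀, e, he⟩ := hE x
  obtain ⟨b₀, -⟩ := Trivializes.exists_stalk_basis he x hxU₀
  obtain ⟨-, t, D, ht, hco, hD⟩ := exists_isCoordinate_stalk C x hx
  have htm : t ∈ IsLocalRing.maximalIdeal (C.X.presheaf.stalk x) :=
    ht ▸ Ideal.mem_span_singleton_self t
  have : CharP C.K p := charP_of_injective_algebraMap (algebraMap k C.K).injective p
  have hp (v : genericFibre E) : p • v = 0 := by
    rw [← Nat.cast_smul_eq_nsmul C.K, CharP.cast_eq_zero, zero_smul]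
  -- a basis of eigenvectors of the stalk at `x`
  obtain ⟨b, g, n, hg⟩ := exists_eigenbasis p hp b₀ (stalkToGeneric_injective hE x)
    (hco.iterate_covDeriv_eq hcurv) fun s ↦
      covDeriv_mem_range_of_regularForms (stalkToGeneric_smul C E x) hD (hlog x t htm s)
  -- its extension to a neighbourhood
  obtain ⟨V₁, hxV₁, hV₁, s, hs⟩ := exists_germ_family_modules hxU₀ fun i ↦ EpsExt.fst (g i)
  obtain ⟨V₂, hxV₂, hV₂, s', hs'⟩ := exists_germ_family_modules hxV₁ fun i ↦ EpsExt.snd (g i)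
  obtain ⟨V₃, hV₃, hxV₃, htriv⟩ := Trivializes.exists_of_stalk_basis he hxV₂ (hV₂.trans hV₁)
    (fun i ↦ res E hV₂ (s i)) b fun i ↦ by rw [germ_res, hs, (hg i).2.1]
  obtain ⟨V₄, hxV₄, τ, hτ, hunit⟩ := exists_uniformizer_section C hx ht
  have hU₃ : V₃ ⊓ V₄ ≤ V₃ := inf_le_left
  have hU₄ : V₃ ⊓ V₄ ≤ V₄ := inf_le_right
  refine ⟨V₃ ⊓ V₄, ⟨hxV₃, hxV₄⟩, stalkToK C x t, D, hco,
    fun i ↦ EpsExt.mk (res E (hU₃.trans (hV₃.trans hV₂)) (s i)) (res E (hU₃.trans hV₃) (s' i)),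
    n, resO hU₄ τ, fun W _ hW ↦ ?_⟩
  have : Nonempty V₁ := ⟨⟨x, hxV₁⟩⟩
  have : Nonempty V₂ := ⟨⟨x, hxV₂⟩⟩
  have : Nonempty V₄ := ⟨⟨x, hxV₄⟩⟩
  have : Nonempty (V₃ ⊓ V₄ : C.X.Opens) := ⟨⟨x, hxV₃, hxV₄⟩⟩
  obtain ⟨bW, hbW⟩ := htriv W (hW.trans hU₃)
  simp only [res_res] at hbW
  obtain ⟨bη, hbη⟩ := htriv.exists_stalk_basis (genericPoint C.X) (hU₃ (hW (generic_mem C W)))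
  have hτW : toK C W (resO hW (resO hU₄ τ)) = stalkToK C x t := by
    rw [toK_resO, toK_resO, ← hτ, stalkToK_germ]
  have hmap (i : Fin r) : EpsExt.map (toGeneric E W) (EpsExt.map (res E hW)
      (EpsExt.mk (res E (hU₃.trans (hV₃.trans hV₂)) (s i)) (res E (hU₃.trans hV₃) (s' i)))) =
      EpsExt.map (stalkToGeneric E x) (g i) := by
    refine EpsExt.ext ?_ ?_
    · simp only [EpsExt.fst_map, EpsExt.fst_mk]
      rw [toGeneric_res, toGeneric_res, ← hs, stalkToGeneric_germ]
    · simp only [EpsExt.snd_map, EpsExt.snd_mk]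
      rw [toGeneric_res, toGeneric_res, ← hs', stalkToGeneric_germ]
  refine ⟨bW, toK_injective C W, fun i ↦ ?_, fun i ↦ ?_, ?_, hτW, fun i a c hac ↦ ?_⟩
  · rw [hbW, EpsExt.fst_map, EpsExt.fst_mk, res_res]
  · rw [hmap]
    exact (hg i).2.2
  · have : (fun i ↦ toGeneric E W (bW i)) = bη := by
      funext i
      rw [hbη, germ_res, germ_res, hbW, toGeneric_res]
      rfl
    rw [this]
    exact bη.linearIndependent
  · refine exists_toK_eq_of_pow C (hg i).1 hx ht hτW (fun y hy hyx ↦ ?_) hac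
    rw [germ_resO, germ_resO]
    exact hunit y _ hyx

end Global

end LogConn

end

/-- Let `C₀` be a smooth proper curve over `k`, `E₀` a vector bundle on `C₀`, and `∇` a logarithmic
connection on `E = E₀[ε]` over `C = C₀[ε]` with vanishing `p`-curvature, all of whose poles are
poles of the induced connection `∇₀` on `E₀`. Suppose that the exponents of `∇₀` at its poles are
all non-zero. Then the sheaf of horizontal sections of `∇` is locally free on `C ^ (p)`, of rank
equal to that of `E`, and its reduction modulo `ε` is the sheaf of horizontal sections of `∇₀`. -/
theorem mainTheorem6 {k : Type u} [Field k] [IsAlgClosed k] (p : ℕ) [Fact p.Prime] [CharP k p]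
    (C₀ : LogConn.SmoothProperCurve k) (E₀ : C₀.X.Modules) (r : ℕ)
    (hE₀ : LogConn.IsVectorBundle E₀ r)
    (nabla : LogConn.RatConnectionEps E₀)
    (hlog : LogConn.IsLogarithmicEps nabla)
    (hcurv : nabla.HasVanishingPCurvature p)
    (hpoles : ∀ x : C₀.X, LogConn.IsPoleEps nabla x → LogConn.IsPole nabla.reduction x)
    (hexp : ∀ x : C₀.X, LogConn.IsPole nabla.reduction x →
      ∀ e : k, LogConn.IsExponent nabla.reduction x e → e ≠ 0) :
    LogConn.KernelIsLocallyFree p nabla r ∧ LogConn.KernelQuotientMapIsIso p nabla := by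
  have hK : Algebra.EssFiniteType k C₀.K := LogConn.essFiniteType_functionField C₀
  constructor
  · intro x
    obtain ⟨z, -, hz, hxz⟩ := LogConn.exists_closedPoint C₀ (W := ⊤) (y := x) trivial
    obtain ⟨U, hzU, t, D, hco, g, n, τ, hF⟩ := LogConn.exists_eigenFrame hE₀ hlog hcurv hz
    have hU : Nonempty U := ⟨⟨z, hzU⟩⟩
    obtain ⟨b, F⟩ := hF U le_rfl
    refine ⟨U, hU, hxz.mem_open U.isOpen hzU,
      fun i ↦ ⟨_, F.smul_mem_horizontal hco (LogConn.toGeneric_smul E₀ U) i⟩, fun W _ hW ↦ ?_⟩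
    obtain ⟨bW, FW⟩ := hF W hW
    have hmap (i : Fin r) : LogConn.EpsExt.map (LogConn.res E₀ hW)
        ((TrivSqZeroExt.inl (LogConn.resO le_rfl τ ^ n i) : Γ(C₀.X, U)[ε]) •
          LogConn.EpsExt.map (LogConn.res E₀ le_rfl) (g i)) =
        (TrivSqZeroExt.inl (LogConn.resO hW τ ^ n i) : Γ(C₀.X, W)[ε]) •
          LogConn.EpsExt.map (LogConn.res E₀ hW) (g i) := by
      rw [LogConn.map_res_inl_smul, map_pow, LogConn.resO_resO]
      congr 1
      exact LogConn.EpsExt.ext (LogConn.res_res E₀ hW le_rfl _) (LogConn.res_res E₀ hW le_rfl _)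
    obtain ⟨B, hB⟩ := FW.exists_basis hco (LogConn.toGeneric_smul E₀ W)
      (fun i ↦ ⟨_, FW.smul_mem_horizontal hco (LogConn.toGeneric_smul E₀ W) i⟩) fun i ↦ rfl
    exact ⟨B, fun i ↦ (congrArg Subtype.val (hB i)).trans (hmap i).symm⟩
  · intro x
    obtain ⟨z, -, hz, hxz⟩ := LogConn.exists_closedPoint C₀ (W := ⊤) (y := x) trivial
    obtain ⟨U, hzU, t, D, hco, g, n, τ, hF⟩ := LogConn.exists_eigenFrame hE₀ hlog hcurv hz
    refine ⟨U, hxz.mem_open U.isOpen hzU, fun W _ hW ↦ ?_⟩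
    obtain ⟨b, F⟩ := hF W hW
    exact F.bijective_horizontalQuotientMap hco (LogConn.toGeneric_smul E₀ W)
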